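/- **Theorem 5 (Exponential behavior of i.i.d. random codes).** Let $\mathcal X,\mathcal Y$ be finite alphabets, $P_{Y|X}$ a channel from $\mathcal X$ to $\mathcal Y$, $Q_Y$ a distribution on $\mathcal Y$, and $P_X$ a distribution on $\mathcal X$ that induces $Q_Y$, i.e. $\sum_x P_X(x)P_{Y|X}(y|x)=Q_Y(y)$ for all $y$. Put $P_{XY}(x,y)=P_X(x)P_{Y|X}(y|x)$ and assume $P_{XY}\neq P_X\times Q_Y$. With natural logarithms, let $$D(P\|Q)=\sum_a P(a)\log\frac{P(a)}{Q(a)},\qquad D_{1+s}(P\|Q)=\frac1s\log\sum_a P(a)^{1+s}Q(a)^{-s}\ (s\neq0),\qquad D_1(P\|Q)=D(P\|Q).$$ Let $R$ be a real number and let $M_n$ be nonnegative integers with $\frac1n\log M_n\to R$ (for instance $M_n=\lceil e^{nR}\rceil$). Let $U_n=(X^n(1),\dots,X^n(M_n))$ be the random codebook whose codewords are independent, each with distribution $P_X^n$, and let $$P_{Y^n|U_n}(y^n|u)=\frac1{M_n}\sum_{m=1}^{M_n}\prod_{i=1}^nP_{Y|X}(y_i|u_i(m))$$ be the output distribution for a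 uniformly distributed message; $P_{Y^nU_n}=P_{U_n}P_{Y^n|U_n}$ and $Q_{Y^n}=Q_Y^n$. Let $s\in(-1,1]$. Assume $R>D_{1+s}(P_{XY}\|P_X\times Q_Y)$ if $s\in(0,1]$, and $R>D(P_{Y|X}\|Q_Y|P_X):=\sum_xP_X(x)D(P_{Y|X}(\cdot|x)\|Q_Y)$ if $s\in(-1,0]$. Then $D_{1+s}(P_{Y^nU_n}\|Q_{Y^n}\times P_{U_n})>0$ for all large $n$, and $$\lim_{n\to\infty}-\frac1n\log D_{1+s}(P_{Y^nU_n}\|Q_{Y^n}\times P_{U_n})=\mathsf E_{\mathsf{iid}},$$ where $$\mathsf E_{\mathsf{iid}}=\begin{cases}\max_{t\in[s,1]}t\left(R-D_{1+t}(P_{XY}\|P_X\times Q_Y)\right), & s\in(0,1],\\[2pt] \max_{t\in[0,1]}t\left(R-D_{1+t}(P_{XY}\|P_X\times Q_Y)\right), & s\in(-1,0],\end{cases}$$ and the maximum is attained. -/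

import Mathlib

open Filter Topology

noncomputable section

namespace Resolvability

/-! Distributions on a finite alphabet `α` are points of `stdSimplex ℝ α`; a channel from `𝒳` to
`𝒴` is a function `W : 𝒳 → 𝒴 → ℝ` with `W x ∈ stdSimplex ℝ 𝒴` for every `x`. -/

variable {𝒳 𝒴 : Type*} [Fintype 𝒳] [Fintype 𝒴]

/-- Relative entropy `D(P‖Q) = ∑ P log (P / Q)` in nats, with `0 log 0 = 0`; this is the finite
value of the divergence, to be used for `P ≪ Q`. -/
def relEntropy {α : Type*} [Fintype α] (P Q : α → ℝ) : ℝ :=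
  ∑ a, P a * Real.log (P a / Q a)

/-- Rényi divergence `D_{1+s}(P‖Q) = s⁻¹ log ∑ P^{1+s} Q^{-s}` of order `1 + s > 0`, which is the
relative entropy for `s = 0`; as for `relEntropy`, to be used for `P ≪ Q`. -/
def renyiDiv {α : Type*} [Fintype α] (s : ℝ) (P Q : α → ℝ) : ℝ :=
  if s = 0 then relEntropy P Q
  else 1 / s * Real.log (∑ a, P a ^ (1 + s) * Q a ^ (-s))

/-- Conditional relative entropy `D(P_{Y|X}‖Q_Y|P_X) = ∑ₓ P_X(x) D(P_{Y|X}(·|x)‖Q_Y)`. -/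
def condRelEntropy (W : 𝒳 → 𝒴 → ℝ) (Q : 𝒴 → ℝ) (P : 𝒳 → ℝ) : ℝ :=
  ∑ x, P x * relEntropy (W x) Q

/-- The output distribution `P_{Y|X} ∘ P_X`. -/
def outputDist (W : 𝒳 → 𝒴 → ℝ) (P : 𝒳 → ℝ) : 𝒴 → ℝ :=
  fun y => ∑ x, W x y * P x

/-- The set `𝒫(P_{Y|X}, Q_Y)` of the input distributions that induce the output `Q_Y`. -/
def inducing (W : 𝒳 → 𝒴 → ℝ) (Q : 𝒴 → ℝ) : Set (𝒳 → ℝ) :=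
  {P | P ∈ stdSimplex ℝ 𝒳 ∧ outputDist W P = Q}

/-- The joint distribution `P_{XY}(x, y) = P_X(x) P_{Y|X}(y|x)`. -/
def jointDist (P : 𝒳 → ℝ) (W : 𝒳 → 𝒴 → ℝ) : 𝒳 × 𝒴 → ℝ :=
  fun z => P z.1 * W z.1 z.2

/-- The product of two distributions. -/
def prodDist {α β : Type*} (P : α → ℝ) (Q : β → ℝ) : α × β → ℝ :=
  fun z => P z.1 * Q z.2

/-- The `n`-fold i.i.d. product `P^n`. -/
def iidDist {α : Type*} (n : ℕ) (P : α → ℝ) : (Fin n → α) → ℝ :=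
  fun a => ∏ i, P (a i)

/-- A codebook: `M` codewords of length `n`; the message `m` is encoded as `u m`. -/
abbrev Codebook (𝒳 : Type*) (n M : ℕ) : Type _ := Fin M → Fin n → 𝒳

/-- The law `P_{U_n}` of the i.i.d. random codebook: the codewords are independent, each with
distribution `P_X^n`. -/
def codebookDist (n M : ℕ) (P : 𝒳 → ℝ) : Codebook 𝒳 n M → ℝ :=
  iidDist M (iidDist n P)

/-- The output distribution
`P_{Y^n|U_n}(y^n|u) = (1 / M) ∑ₘ ∏ᵢ P_{Y|X}(yᵢ | u_i(m))` for a uniform message. -/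
def codeOutput {n M : ℕ} (W : 𝒳 → 𝒴 → ℝ) (u : Codebook 𝒳 n M) : (Fin n → 𝒴) → ℝ :=
  fun y => 1 / (M : ℝ) * ∑ m, ∏ i, W (u m i) (y i)

/-- The joint distribution `P_{Y^n U_n}` of channel output and random codebook. -/
def codeJoint (n M : ℕ) (P : 𝒳 → ℝ) (W : 𝒳 → 𝒴 → ℝ) :
    (Fin n → 𝒴) × Codebook 𝒳 n M → ℝ :=
  fun z => codebookDist n M P z.2 * codeOutput W z.2 z.1

/-- The Rényi resolvability measure `D_{1+s}(P_{Y^n U_n}‖Q_Y^n × P_{U_n})` of the i.i.d. random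
code with `M` codewords of length `n`. -/
def iidResolvability (s : ℝ) (n M : ℕ) (P : 𝒳 → ℝ) (W : 𝒳 → 𝒴 → ℝ) (Q : 𝒴 → ℝ) : ℝ :=
  renyiDiv s (codeJoint n M P W) (prodDist (iidDist n Q) (codebookDist n M P))

/-- The values `t (R - D_{1+t}(P_{XY}‖P_X × Q_Y))` over which the exponent maximizes:
`t ∈ [s, 1]` if `s > 0`, and `t ∈ [0, 1]` otherwise. -/
def exponentValues (s R : ℝ) (P : 𝒳 → ℝ) (W : 𝒳 → 𝒴 → ℝ) (Q : 𝒴 → ℝ) : Set ℝ :=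
  (fun t => t * (R - renyiDiv t (jointDist P W) (prodDist P Q))) ''
    (if 0 < s then Set.Icc s 1 else Set.Icc 0 1)

/-- The exponent `E_iid(P_X, P_{Y|X}, Q_Y)`, the largest of the `exponentValues`. -/
def Eiid (s R : ℝ) (P : 𝒳 → ℝ) (W : 𝒳 → 𝒴 → ℝ) (Q : 𝒴 → ℝ) : ℝ :=
  sSup (exponentValues s R P W Q)

/-- If `P_X` induces `Q_Y`, then `P_{XY} ≪ P_X × Q_Y`. -/
theorem jointDist_absolutelyContinuous {P : 𝒳 → ℝ} {W : 𝒳 → 𝒴 → ℝ} {Q : 𝒴 → ℝ}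
    (hW : ∀ x, W x ∈ stdSimplex ℝ 𝒴) (hP : P ∈ inducing W Q) (z : 𝒳 × 𝒴)
    (hz : prodDist P Q z = 0) : jointDist P W z = 0 := by
  obtain ⟨hP1, rfl⟩ := hP
  rcases mul_eq_zero.1 hz with h | h
  · simp [jointDist, h]
  · have := (Finset.sum_eq_zero_iff_of_nonneg
      (fun x _ => mul_nonneg ((hW x).1 z.2) (hP1.1 x))).1 h z.1 (Finset.mem_univ _)
    simpa [jointDist, mul_comm] using this

/-- If `P_X` induces `Q_Y`, then `P_{Y^n U_n} ≪ Q_Y^n × P_{U_n}`. -/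
theorem codeJoint_absolutelyContinuous {P : 𝒳 → ℝ} {W : 𝒳 → 𝒴 → ℝ} {Q : 𝒴 → ℝ}
    (hW : ∀ x, W x ∈ stdSimplex ℝ 𝒴) (hP : P ∈ inducing W Q) (n M : ℕ)
    (z : (Fin n → 𝒴) × Codebook 𝒳 n M)
    (hz : prodDist (iidDist n Q) (codebookDist n M P) z = 0) : codeJoint n M P W z = 0 := by
  by_cases h : codebookDist n M P z.2 = 0
  · simp [codeJoint, h]
  · have hQ : iidDist n Q z.1 = 0 := (mul_eq_zero.1 hz).resolve_right h
    obtain ⟨i, -, hi⟩ := Finset.prod_eq_zero_iff.1 hQ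
    have hz0 : ∀ m, ∏ j, W (z.2 m j) (z.1 j) = 0 := by
      intro m
      refine Finset.prod_eq_zero (Finset.mem_univ i) ?_
      have hPm : P (z.2 m i) ≠ 0 := by
        intro h0
        exact h (Finset.prod_eq_zero (Finset.mem_univ m)
          (Finset.prod_eq_zero (Finset.mem_univ i) h0))
      have := jointDist_absolutelyContinuous hW hP (z.2 m i, z.1 i) (by simp [prodDist, hi])
      exact (mul_eq_zero.1 this).resolve_left hPm
    simp [codeJoint, codeOutput, hz0]

end Resolvability

end

/-! Relative to `Q_Y^n × P_{U_n}`, the joint law of output and codebook has density `T`, the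
empirical mean over the codewords of `f = P_{Y|X}^n / Q_Y^n`. Given an output of positive
probability, `T` averages `M` independent copies of a variable of mean one, so the divergence
measures how far `T` fluctuates around 1. Write `K(t) = t D_{1+t}(P_{XY}‖P_X × Q_Y)`, so that `f ^
(1 + t)` has mean `e^{nK(t)}` under `P_X^n × Q_Y^n`.

Upper bound: for concave `H`, bounding `T H(T)` by tangents at points that depend on one codeword
only (`expIid_mul_sampleMean_le`) gives a multiple of `M^{-t} E f^{1+t}` for every admissible `t >
0`, hence the exponent `tR - K(t)`. For `s ≤ 0` the relative entropy serves as upper bound.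

Lower bound: `K` is convex, and the tilted mean `μ(t)` of the information density is its slope. If
`tR - K(t)` is maximal over `[0, 1]` at some `t ≥ s`, `t > 0`, then `μ(t) ≤ R` and `(1 - t)(R -
μ(t)) = 0`. The quantity `1 - E√T` bounds every order from below, and it is about the variance of
`T`, at least of order `E[f² ; f ≈ e^{nμ}] / M`. Under the tilted law the window `f ≈ e^{nμ}` is
typical, so this has exponent `R - (1 - t)μ - K(t) = tR - K(t)`. Otherwise `μ(s) > R` and the
maximum over `[s, 1]` sits at `s`: a single codeword with `f > 2M` dominates, and `E T^{1+s} - 1` is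
at least of order `M^{-s} E[f^{1+s} ; f ≥ 2M]`. -/

noncomputable section

namespace Resolvability

/-! ### Expectations over i.i.d. samples -/

/-- The expectation of `F` over `M` independent samples from `w`. -/
def expIid {α : Type*} [Fintype α] (M : ℕ) (w : α → ℝ) (F : (Fin M → α) → ℝ) : ℝ :=
  ∑ u, iidDist M w u * F u

section expIid

variable {α : Type*} [Fintype α] {M : ℕ} {w : α → ℝ}

omit [Fintype α] in
theorem iidDist_nonneg (hw : ∀ a, 0 ≤ w a) (u : Fin M → α) : 0 ≤ iidDist M w u :=
  Finset.prod_nonneg fun _ _ => hw _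

theorem sum_prod_apply (f : Fin M → α → ℝ) : ∑ u : Fin M → α, ∏ i, f i (u i) = ∏ i, ∑ a, f i a := by
  classical
  rw [Finset.prod_univ_sum, Fintype.piFinset_univ]

theorem sum_iidDist (hw : ∑ a, w a = 1) : ∑ u, iidDist M w u = 1 := by
  have := sum_prod_apply (M := M) (fun _ => w)
  simpa [iidDist, hw] using this

theorem iidDist_mem_stdSimplex (hw : w ∈ stdSimplex ℝ α) :
    iidDist M w ∈ stdSimplex ℝ (Fin M → α) :=
  ⟨iidDist_nonneg hw.1, sum_iidDist hw.2⟩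

theorem expIid_add (F G : (Fin M → α) → ℝ) :
    expIid M w (fun u => F u + G u) = expIid M w F + expIid M w G := by
  simp [expIid, mul_add, Finset.sum_add_distrib]

theorem expIid_sub (F G : (Fin M → α) → ℝ) :
    expIid M w (fun u => F u - G u) = expIid M w F - expIid M w G := by
  simp [expIid, mul_sub, Finset.sum_sub_distrib]

theorem expIid_const_mul (c : ℝ) (F : (Fin M → α) → ℝ) :
    expIid M w (fun u => c * F u) = c * expIid M w F := by
  simp only [expIid, Finset.mul_sum]
  exact Finset.sum_congr rfl fun _ _ => by ring

theorem expIid_sum {ι : Type*} (s : Finset ι) (F : ι → (Fin M → α) → ℝ) :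
    expIid M w (fun u => ∑ i ∈ s, F i u) = ∑ i ∈ s, expIid M w (F i) := by
  simp only [expIid, Finset.mul_sum]
  exact Finset.sum_comm

theorem expIid_const (hw : ∑ a, w a = 1) (c : ℝ) : expIid M w (fun _ => c) = c := by
  rw [expIid, ← Finset.sum_mul, sum_iidDist hw, one_mul]

theorem expIid_mono (hw : ∀ a, 0 ≤ w a) {F G : (Fin M → α) → ℝ} (h : ∀ u, F u ≤ G u) :
    expIid M w F ≤ expIid M w G :=
  Finset.sum_le_sum fun u _ => mul_le_mul_of_nonneg_left (h u) (iidDist_nonneg hw u)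

theorem expIid_zero (F : (Fin 0 → α) → ℝ) : expIid 0 w F = F Fin.elim0 := by
  simp [expIid, iidDist, Subsingleton.elim (default : Fin 0 → α) Fin.elim0]

theorem expIid_succ (F : (Fin (M + 1) → α) → ℝ) :
    expIid (M + 1) w F = ∑ a, w a * expIid M w (fun u => F (Fin.cons a u)) := by
  rw [expIid, ← (Fin.consEquiv fun _ => α).sum_comp, Fintype.sum_prod_type]
  refine Finset.sum_congr rfl fun a _ => ?_
  rw [expIid, Finset.mul_sum]
  refine Finset.sum_congr rfl fun u _ => ?_
  simp [iidDist, Fin.consEquiv, Fin.prod_univ_succ, mul_assoc]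

theorem expIid_apply_mul (hw : ∑ a, w a = 1) {m m' : Fin M} (hm : m ≠ m') (F G : α → ℝ) :
    expIid M w (fun u => F (u m) * G (u m')) = (∑ a, w a * F a) * ∑ a, w a * G a := by
  have key := sum_prod_apply (M := M) fun i a =>
    w a * ((if i = m then F a else 1) * if i = m' then G a else 1)
  simp only [Finset.prod_mul_distrib, Finset.prod_ite_eq', Finset.mem_univ, if_true] at key
  rw [expIid]
  refine (Finset.sum_congr rfl fun u _ => by rw [iidDist]).trans (key.trans ?_)
  rw [Finset.prod_eq_mul m m' hm]
  · simp [hm, hm.symm]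
  · intro i _ hi
    simp [hi.1, hi.2, hw]
  all_goals simp

theorem expIid_apply (hw : ∑ a, w a = 1) (m : Fin M) (F : α → ℝ) :
    expIid M w (fun u => F (u m)) = ∑ a, w a * F a := by
  have key := sum_prod_apply (M := M) fun i a => w a * if i = m then F a else 1
  simp only [Finset.prod_mul_distrib, Finset.prod_ite_eq', Finset.mem_univ, if_true] at key
  rw [expIid]
  refine (Finset.sum_congr rfl fun u _ => by rw [iidDist]).trans (key.trans ?_)
  rw [Finset.prod_eq_single m]
  · simp
  · intro i _ hi
    simp [hi, hw]
  · simp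

theorem expIid_sum_apply (hw : ∑ a, w a = 1) (d : α → ℝ) :
    expIid M w (fun u => ∑ m, d (u m)) = M * ∑ a, w a * d a := by
  simp [expIid_sum, expIid_apply hw]

theorem expIid_sq_sum (hw : ∑ a, w a = 1) {d : α → ℝ} (hd : ∑ a, w a * d a = 0) :
    expIid M w (fun u => (∑ m, d (u m)) ^ 2) = M * ∑ a, w a * d a ^ 2 := by
  induction M with
  | zero => simp [expIid_zero]
  | succ k ih =>
    have h (a : α) : expIid k w (fun u => (∑ m, d ((Fin.cons a u : Fin (k + 1) → α) m)) ^ 2) =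
        d a ^ 2 + k * ∑ a, w a * d a ^ 2 := by
      simp only [Fin.sum_univ_succ, Fin.cons_zero, Fin.cons_succ, add_sq, expIid_add,
        expIid_const hw, expIid_const_mul, expIid_sum_apply hw, hd, ih]
      ring
    simp only [expIid_succ, h, mul_add, Finset.sum_add_distrib, ← Finset.sum_mul, hw]
    push_cast
    ring

theorem expIid_pow_four_sum_le (hw : ∑ a, w a = 1) {d : α → ℝ}
    (hd : ∑ a, w a * d a = 0) :
    expIid M w (fun u => (∑ m, d (u m)) ^ 4) ≤
      M * ∑ a, w a * d a ^ 4 + 3 * (M * ∑ a, w a * d a ^ 2) ^ 2 := by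
  induction M with
  | zero => simp [expIid_zero]
  | succ k ih =>
    -- The third moment of the remaining sum multiplies `d a`, which has mean zero, so it never
    -- needs a bound.
    have h (a : α) : expIid k w (fun u => (∑ m, d ((Fin.cons a u : Fin (k + 1) → α) m)) ^ 4) =
        d a ^ 4 + (6 * (k * ∑ a, w a * d a ^ 2)) * d a ^ 2 +
          4 * expIid k w (fun u => (∑ m, d (u m)) ^ 3) * d a +
          expIid k w (fun u => (∑ m, d (u m)) ^ 4) := by
      have e (S : ℝ) : (d a + S) ^ 4 = d a ^ 4 + 4 * d a ^ 3 * S + 6 * d a ^ 2 * S ^ 2 +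
          4 * d a * S ^ 3 + S ^ 4 := by ring
      simp only [Fin.sum_univ_succ, Fin.cons_zero, Fin.cons_succ, e, expIid_add,
        expIid_const hw, expIid_const_mul, expIid_sum_apply hw, hd, expIid_sq_sum hw hd]
      ring
    have e (a : α) (x y z : ℝ) : w a * (d a ^ 4 + x * d a ^ 2 + y * d a + z) =
        w a * d a ^ 4 + x * (w a * d a ^ 2) + y * (w a * d a) + w a * z := by ring
    simp only [expIid_succ, h, e, Finset.sum_add_distrib, ← Finset.sum_mul, ← Finset.mul_sum, hw,
      hd]
    push_cast
    nlinarith [sq_nonneg (∑ a, w a * d a ^ 2)]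

/-- Jensen's inequality for the square root, one sample at a time. -/
theorem expIid_sqrt_sum_mono (hw0 : ∀ a, 0 ≤ w a) {f g : α → ℝ}
    (hf : ∀ a, 0 ≤ f a) (hg : ∀ a, 0 ≤ g a)
    (h : ∀ c, 0 ≤ c → ∑ a, w a * √(f a + c) ≤ ∑ a, w a * √(g a + c)) (c : ℝ) (hc : 0 ≤ c) :
    expIid M w (fun u => √((∑ m, f (u m)) + c)) ≤
      expIid M w (fun u => √((∑ m, g (u m)) + c)) := by
  induction M generalizing c with
  | zero => simp [expIid_zero]
  | succ k ih =>
    simp only [expIid_succ, Fin.sum_univ_succ, Fin.cons_zero, Fin.cons_succ]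
    -- The offset `c` absorbs the samples held fixed: first the new sample, for the induction
    -- hypothesis, then all the others, for `h`.
    calc ∑ a, w a * expIid k w (fun u => √(f a + ∑ m, f (u m) + c))
        ≤ ∑ a, w a * expIid k w (fun u => √(f a + ∑ m, g (u m) + c)) := by
          refine Finset.sum_le_sum fun a _ => mul_le_mul_of_nonneg_left ?_ (hw0 a)
          have e (S : ℝ) : f a + S + c = S + (f a + c) := by ring
          simpa only [e] using ih (f a + c) (add_nonneg (hf a) hc)
      _ = expIid k w (fun u => ∑ a, w a * √(f a + (∑ m, g (u m) + c))) := by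
          have e (a : α) (S : ℝ) : f a + S + c = f a + (S + c) := by ring
          simp only [expIid_sum, expIid_const_mul, e]
      _ ≤ expIid k w (fun u => ∑ a, w a * √(g a + (∑ m, g (u m) + c))) :=
          expIid_mono hw0 fun u => h _ (add_nonneg (Finset.sum_nonneg fun _ _ => hg _) hc)
      _ = _ := by
          have e (a : α) (S : ℝ) : g a + S + c = g a + (S + c) := by ring
          simp only [expIid_sum, expIid_const_mul, e]

end expIid

/-! ### The empirical mean of likelihood ratios -/

/-- The empirical mean of `f` over a sample. -/
def sampleMean {α : Type*} {M : ℕ} (f : α → ℝ) (u : Fin M → α) : ℝ :=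
  1 / (M : ℝ) * ∑ m, f (u m)

section sampleMean

variable {α : Type*} [Fintype α] {M : ℕ} {w f : α → ℝ}

omit [Fintype α] in
theorem sampleMean_nonneg (hf : ∀ a, 0 ≤ f a) (u : Fin M → α) : 0 ≤ sampleMean f u :=
  mul_nonneg (by positivity) (Finset.sum_nonneg fun _ _ => hf _)

omit [Fintype α] in
theorem div_le_sampleMean (hf : ∀ a, 0 ≤ f a) (u : Fin M → α) (m : Fin M) :
    f (u m) / M ≤ sampleMean f u := by
  rw [sampleMean, div_eq_inv_mul, one_div]
  exact mul_le_mul_of_nonneg_left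
    (Finset.single_le_sum (f := fun m => f (u m)) (fun _ _ => hf _) (Finset.mem_univ m))
    (by positivity)

theorem expIid_sampleMean (hw : ∑ a, w a = 1) (hM : M ≠ 0) :
    expIid M w (sampleMean f) = ∑ a, w a * f a := by
  unfold sampleMean
  rw [expIid_const_mul, expIid_sum_apply hw]
  field_simp

/-- If `H` lies below its tangents at points `τ ≥ 1`, then `E[T H(T)] ≤ E[f H(1 + f / M)]` for the
empirical mean `T` of a function `f` of mean one. -/
theorem expIid_mul_sampleMean_le (hw0 : ∀ a, 0 ≤ w a) (hw : ∑ a, w a = 1)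
    (hf : ∀ a, 0 ≤ f a) (hf1 : ∑ a, w a * f a = 1) (hM : M ≠ 0) {H H' : ℝ → ℝ}
    (hH : ∀ T τ, 0 < T → 1 ≤ τ → H T ≤ H τ + H' τ * (T - τ)) (hH' : ∀ τ, 1 ≤ τ → 0 ≤ H' τ) :
    expIid M w (fun u => sampleMean f u * H (sampleMean f u)) ≤
      ∑ a, w a * (f a * H (1 + f a / M)) := by
  have hM0 : (0 : ℝ) < M := by positivity
  have hτ (a : α) : 1 ≤ 1 + f a / M := le_add_of_nonneg_right (div_nonneg (hf a) hM0.le)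
  -- Given sample `m`, the mean of `T` is `f (u m) / M + 1 - 1 / M`, just below the tangent point `1
  -- + f (u m) / M`. As `H' ≥ 0`, the linear terms contribute at most zero in expectation.
  set G : α → ℝ := fun a => f a * H' (1 + f a / M) with hG
  have hG0 : 0 ≤ ∑ a, w a * G a :=
    Finset.sum_nonneg fun a _ => mul_nonneg (hw0 a) (mul_nonneg (hf a) (hH' _ (hτ a)))
  have hpt (u : Fin M → α) : sampleMean f u * H (sampleMean f u) ≤ 1 / (M : ℝ) * ∑ m,
      (f (u m) * H (1 + f (u m) / M) +
        (1 / (M : ℝ) * ∑ m' ∈ Finset.univ.erase m, G (u m) * f (u m') - G (u m))) := by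
    conv_lhs => rw [sampleMean, mul_assoc, Finset.sum_mul]
    refine mul_le_mul_of_nonneg_left (Finset.sum_le_sum fun m _ => ?_) (by positivity)
    rcases (hf (u m)).eq_or_lt with h0 | h0
    · simp [hG, ← h0]
    · have hT : 0 < sampleMean f u := (div_pos h0 hM0).trans_le (div_le_sampleMean hf u m)
      have hsum : sampleMean f u - (1 + f (u m) / M) =
          1 / (M : ℝ) * ∑ m' ∈ Finset.univ.erase m, f (u m') - 1 := by
        rw [sampleMean, ← Finset.add_sum_erase _ _ (Finset.mem_univ m)]
        ring
      have := mul_le_mul_of_nonneg_left (hH _ _ hT (hτ (u m))) h0.le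
      rw [hsum] at this
      refine this.trans_eq ?_
      rw [← Finset.mul_sum, hG]
      ring
  refine (expIid_mono hw0 hpt).trans ?_
  have hcross (m : Fin M) :
      expIid M w (fun u => ∑ m' ∈ Finset.univ.erase m, G (u m) * f (u m')) =
        ((M : ℝ) - 1) * ∑ a, w a * G a := by
    rw [expIid_sum, Finset.sum_congr rfl fun m' hm' =>
      expIid_apply_mul hw (Finset.ne_of_mem_erase hm').symm G f]
    rw [hf1, Finset.sum_const, Finset.card_erase_of_mem (Finset.mem_univ m), Finset.card_univ,
      Fintype.card_fin, nsmul_eq_mul, Nat.cast_sub (Nat.one_le_iff_ne_zero.2 hM)]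
    simp
  have hH1 (m : Fin M) : expIid M w (fun u => f (u m) * H (1 + f (u m) / M)) =
      ∑ a, w a * (f a * H (1 + f a / M)) :=
    expIid_apply hw m fun a => f a * H (1 + f a / M)
  simp only [expIid_const_mul, expIid_sum, expIid_add, expIid_sub, hcross, hH1,
    expIid_apply hw, Finset.sum_const, Finset.card_univ, Fintype.card_fin, nsmul_eq_mul]
  have : 1 / (M : ℝ) * (M * (∑ a, w a * (f a * H (1 + f a / M)) +
      (1 / (M : ℝ) * ((M - 1) * ∑ a, w a * G a) - ∑ a, w a * G a))) =
      ∑ a, w a * (f a * H (1 + f a / M)) - 1 / (M : ℝ) * ∑ a, w a * G a := by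
    field_simp
    ring
  rw [this]
  exact sub_le_self _ (mul_nonneg (by positivity) hG0)

theorem one_add_rpow_le_one_add_rpow {s t x : ℝ} (hst : s ≤ t) (ht0 : 0 ≤ t) (ht : t ≤ 1)
    (hx : 0 ≤ x) : (1 + x) ^ s ≤ 1 + x ^ t :=
  (Real.rpow_le_rpow_of_exponent_le (by linarith) hst).trans <| by
    simpa using Real.rpow_add_le_add_rpow zero_le_one hx ht0 ht

theorem expIid_sampleMean_rpow_le (hw0 : ∀ a, 0 ≤ w a) (hw : ∑ a, w a = 1)
    (hf : ∀ a, 0 ≤ f a) (hf1 : ∑ a, w a * f a = 1) (hM : M ≠ 0) {s t : ℝ} (hs : 0 < s)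
    (hst : s ≤ t) (ht : t ≤ 1) :
    expIid M w (fun u => sampleMean f u ^ (1 + s)) ≤
      1 + (M : ℝ) ^ (-t) * ∑ a, w a * f a ^ (1 + t) := by
  have hM0 : (0 : ℝ) < M := by positivity
  have h1 (u : Fin M → α) :
      sampleMean f u ^ (1 + s) = sampleMean f u * sampleMean f u ^ s :=
    Real.rpow_one_add' (sampleMean_nonneg hf u) (by linarith)
  simp only [h1]
  -- Concavity of `x ^ s` for `s ≤ 1` supplies the tangent bound, in the form of Bernoulli's
  -- inequality at `T / τ`.
  refine (expIid_mul_sampleMean_le hw0 hw hf hf1 hM (H := fun x => x ^ s)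
    (H' := fun τ => s * τ ^ (s - 1)) ?_ ?_).trans ?_
  · intro T τ hT hτ
    have hτ0 : 0 < τ := by linarith
    have := rpow_one_add_le_one_add_mul_self (s := T / τ - 1) (p := s)
      (by have := div_pos hT hτ0; linarith) hs.le (hst.trans ht)
    rw [add_sub_cancel, Real.div_rpow hT.le hτ0.le, div_le_iff₀ (Real.rpow_pos_of_pos hτ0 s)] at this
    refine this.trans_eq ?_
    rw [Real.rpow_sub_one hτ0.ne']
    field_simp
  · intro τ hτ
    have : 0 < τ := by linarith
    positivity
  · refine le_of_le_of_eq (b := ∑ a, (w a * f a + (M : ℝ) ^ (-t) * (w a * f a ^ (1 + t))))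
      (Finset.sum_le_sum fun a _ => ?_) (by rw [Finset.sum_add_distrib, hf1, Finset.mul_sum])
    have hx : 0 ≤ f a / M := div_nonneg (hf a) hM0.le
    have := mul_le_mul_of_nonneg_left
      (one_add_rpow_le_one_add_rpow hst (hs.le.trans hst) ht hx) (mul_nonneg (hw0 a) (hf a))
    rw [← mul_assoc]
    refine this.trans_eq ?_
    rw [Real.div_rpow (hf a) hM0.le, Real.rpow_neg hM0.le,
      Real.rpow_one_add' (hf a) (by linarith)]
    ring

theorem expIid_sampleMean_mul_log_le (hw0 : ∀ a, 0 ≤ w a) (hw : ∑ a, w a = 1)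
    (hf : ∀ a, 0 ≤ f a) (hf1 : ∑ a, w a * f a = 1) (hM : M ≠ 0) {t : ℝ} (ht0 : 0 < t)
    (ht : t ≤ 1) :
    expIid M w (fun u => sampleMean f u * Real.log (sampleMean f u)) ≤
      1 / t * ((M : ℝ) ^ (-t) * ∑ a, w a * f a ^ (1 + t)) := by
  have hM0 : (0 : ℝ) < M := by positivity
  refine (expIid_mul_sampleMean_le hw0 hw hf hf1 hM (H' := fun τ => 1 / τ) ?_ ?_).trans ?_
  · intro T τ hT hτ
    have hτ0 : 0 < τ := by linarith
    have := Real.log_le_sub_one_of_pos (div_pos hT hτ0)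
    rw [Real.log_div hT.ne' hτ0.ne'] at this
    have e : 1 / τ * (T - τ) = T / τ - 1 := by field_simp
    linarith
  · intro τ hτ
    have : 0 < τ := by linarith
    positivity
  · rw [Finset.mul_sum, Finset.mul_sum]
    refine Finset.sum_le_sum fun a _ => ?_
    have hx : 0 ≤ f a / M := div_nonneg (hf a) hM0.le
    -- The logarithm of `(1 + x) ^ t` is at most `(1 + x) ^ t - 1 ≤ x ^ t`.
    have hlog : t * Real.log (1 + f a / M) ≤ (f a / M) ^ t := by
      rw [← Real.log_rpow (by linarith)]
      have := Real.log_le_sub_one_of_pos (x := (1 + f a / M) ^ t)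
        (Real.rpow_pos_of_pos (by linarith) t)
      have := one_add_rpow_le_one_add_rpow le_rfl ht0.le ht hx
      linarith
    have := mul_le_mul_of_nonneg_left hlog (mul_nonneg (hw0 a) (hf a))
    rw [Real.div_rpow (hf a) hM0.le] at this
    rw [Real.rpow_neg hM0.le, Real.rpow_one_add' (hf a) (by linarith), one_div, ← div_eq_inv_mul,
      le_div_iff₀ ht0]
    calc _ = w a * f a * (t * Real.log (1 + f a / M)) := by ring
      _ ≤ _ := this
      _ = _ := by ring

/-- Strict Bernoulli at 2; it makes the remainder constant `1 - (2 + s) / 2 ^ (1 + s)` positive. -/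
theorem two_add_lt_two_rpow {s : ℝ} (hs : 0 < s) : 2 + s < (2 : ℝ) ^ (1 + s) := by
  have := one_add_mul_self_lt_rpow_one_add (s := 1) (p := 1 + s) (by norm_num) (by norm_num)
    (by linarith)
  norm_num at this
  linarith

/-- A remainder term in Bernoulli's inequality far away from `1`. -/
theorem bernoulli_remainder_le {s T : ℝ} (hs : 0 < s) (hT : 2 ≤ T) :
    1 + (1 + s) * (T - 1) + (1 - (2 + s) / 2 ^ (1 + s)) * T ^ (1 + s) ≤ T ^ (1 + s) := by
  have h2 : (0 : ℝ) < 2 ^ (1 + s) := by positivity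
  -- This is the tangent of `x ^ (1 + s)` at 2 instead of 1. The tangent at 1, scaled to agree with
  -- it at `T = 2`, has the smaller slope and so stays below it for `T ≥ 2`.
  have hb := one_add_mul_self_le_rpow_one_add (s := T / 2 - 1) (p := 1 + s) (by linarith)
    (by linarith)
  rw [add_sub_cancel, Real.div_rpow (by linarith) (by norm_num), le_div_iff₀ h2] at hb
  have h3 : 1 + (1 + s) * (T - 1) ≤ (2 + s) * (1 + (1 + s) * (T / 2 - 1)) := by
    nlinarith [mul_nonneg hs.le (by linarith : 0 ≤ T - 2),
      mul_nonneg (mul_nonneg hs.le hs.le) (by linarith : 0 ≤ T - 2)]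
  have h4 : (2 + s) * (1 + (1 + s) * (T / 2 - 1)) ≤ (2 + s) / 2 ^ (1 + s) * T ^ (1 + s) := by
    rw [div_mul_eq_mul_div, le_div_iff₀ h2, mul_assoc]
    exact mul_le_mul_of_nonneg_left hb (by linarith)
  linarith

/-- The linear part of Bernoulli's inequality averages to 1 because `T` has mean one. The remainder
is active once `T ≥ 2`, which a single sample with `f ≥ 2 * M` already forces; there `T ≥ f / M`. -/
theorem le_expIid_sampleMean_rpow (hw0 : ∀ a, 0 ≤ w a) (hw : ∑ a, w a = 1)
    (hf : ∀ a, 0 ≤ f a) (hf1 : ∑ a, w a * f a = 1) (hM : M ≠ 0) {s : ℝ} (hs : 0 < s) :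
    1 + (1 - (2 + s) / 2 ^ (1 + s)) *
        ((M : ℝ) ^ (-s) * ∑ a, w a * if 2 * M ≤ f a then f a ^ (1 + s) else 0) ≤
      expIid M w (fun u => sampleMean f u ^ (1 + s)) := by
  have hM0 : (0 : ℝ) < M := by positivity
  set k : ℝ := 1 - (2 + s) / 2 ^ (1 + s) with hk
  have hk0 : 0 ≤ k := by
    rw [hk, sub_nonneg, div_le_one (by positivity)]
    exact (two_add_lt_two_rpow hs).le
  set h : α → ℝ := fun a => f a * if 2 * M ≤ f a then (f a / M) ^ s else 0 with hh
  have hpt (u : Fin M → α) : 1 + (1 + s) * (sampleMean f u - 1) + k * sampleMean h u ≤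
      sampleMean f u ^ (1 + s) := by
    have hT0 := sampleMean_nonneg hf u
    have hT : sampleMean h u ≤
        sampleMean f u * if 2 ≤ sampleMean f u then sampleMean f u ^ s else 0 := by
      conv_rhs => rw [sampleMean, mul_assoc, Finset.sum_mul]
      rw [sampleMean]
      refine mul_le_mul_of_nonneg_left (Finset.sum_le_sum fun m _ => ?_) (by positivity)
      refine mul_le_mul_of_nonneg_left ?_ (hf _)
      have hle := div_le_sampleMean hf u m
      split_ifs with h1 h2 h2
      · exact Real.rpow_le_rpow (div_nonneg (hf _) hM0.le) hle hs.le
      · exact absurd (((le_div_iff₀ hM0).2 h1).trans hle) h2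
      · positivity
      · rfl
    rcases le_or_gt 2 (sampleMean f u) with h2 | h2
    · rw [if_pos h2, ← Real.rpow_one_add' hT0 (by linarith)] at hT
      linarith [bernoulli_remainder_le hs h2, mul_le_mul_of_nonneg_left hT hk0]
    · rw [if_neg h2.not_ge, mul_zero] at hT
      have := one_add_mul_self_le_rpow_one_add (s := sampleMean f u - 1) (p := 1 + s)
        (by linarith) (by linarith)
      rw [add_sub_cancel] at this
      nlinarith
  refine le_trans (le_of_eq ?_) (expIid_mono hw0 hpt)
  simp only [expIid_add, expIid_const_mul, expIid_sub, expIid_const hw, expIid_sampleMean hw hM,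
    hf1, sub_self, mul_zero, add_zero]
  rw [Finset.mul_sum]
  congr 2
  refine Finset.sum_congr rfl fun a _ => ?_
  simp only [hh]
  split_ifs
  · rw [Real.div_rpow (hf a) hM0.le, Real.rpow_neg hM0.le,
      Real.rpow_one_add' (hf a) (by linarith)]
    ring
  · simp

end sampleMean

/-! ### Fluctuations of the square root of the empirical mean. -/

section sampleMean

variable {α : Type*} [Fintype α] {M : ℕ} {w f : α → ℝ}

/-- With `x = r ^ 2 - 1` the concavity gap on the right is `(r - 1) ^ 2 / 2`. The polynomial on the
left is at most `x ^ 2 = (r - 1) ^ 2 * (r + 1) ^ 2`, which suffices for `r ≤ 2`, and at most 1,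
which suffices beyond. The parameter `c` scales down the fourth moment. -/
theorem one_add_half_sub_sqrt_ge {x c : ℝ} (hx : -1 ≤ x) (hc : c ≤ 1) :
    1 / 18 * (c * x ^ 2 - c ^ 2 / 4 * x ^ 4) ≤ 1 + 1 / 2 * x - √(1 + x) := by
  have hr0 : 0 ≤ √(1 + x) := Real.sqrt_nonneg _
  have hr : √(1 + x) ^ 2 = 1 + x := Real.sq_sqrt (by linarith)
  generalize √(1 + x) = r at hr0 hr ⊢
  obtain rfl : x = r ^ 2 - 1 := by linarith
  have h1 : c * (r ^ 2 - 1) ^ 2 - c ^ 2 / 4 * (r ^ 2 - 1) ^ 4 ≤ 1 := by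
    nlinarith [sq_nonneg (c * (r ^ 2 - 1) ^ 2 / 2 - 1)]
  have h2 : c * (r ^ 2 - 1) ^ 2 - c ^ 2 / 4 * (r ^ 2 - 1) ^ 4 ≤ (r ^ 2 - 1) ^ 2 := by
    nlinarith [sq_nonneg (r ^ 2 - 1), sq_nonneg (c * (r ^ 2 - 1) ^ 2)]
  have h3 : (r ^ 2 - 1) ^ 2 = (r - 1) ^ 2 * (r + 1) ^ 2 := by ring
  have h4 : c * (r ^ 2 - 1) ^ 2 - c ^ 2 / 4 * (r ^ 2 - 1) ^ 4 ≤ 9 * (r - 1) ^ 2 := by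
    rcases le_total r 2 with h | h
    · have : (r + 1) ^ 2 ≤ 9 := by nlinarith
      nlinarith [sq_nonneg (r - 1)]
    · nlinarith
  nlinarith

/-- A second and fourth moment bound for the square root of a mean of independent samples. -/
theorem expIid_sqrt_sampleMean_le_of_bounded (hw0 : ∀ a, 0 ≤ w a) (hw : ∑ a, w a = 1)
    (hf : ∀ a, 0 ≤ f a) (hf1 : ∑ a, w a * f a = 1) (hM : M ≠ 0) {B : ℝ} (hB : 1 ≤ B)
    (hfB : ∀ a, f a ≤ B) :
    1 / (36 * M * (1 + B / M) ^ 2) * ∑ a, w a * (f a - 1) ^ 2 ≤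
      1 - expIid M w (fun u => √(sampleMean f u)) := by
  have hM0 : (0 : ℝ) < M := by positivity
  set b : ℝ := B / M with hb
  have hb0 : 0 ≤ b := by positivity
  -- Chosen so that `c * (b ^ 2 + 3 * b) ≤ 2`: the fourth-moment term then takes away at most half
  -- of the second-moment term.
  set c : ℝ := 1 / (1 + b) ^ 2 with hc
  have hc0 : 0 ≤ c := by positivity
  have hc1 : c ≤ 1 := by
    rw [hc, div_le_one (by positivity)]
    nlinarith
  set d : α → ℝ := fun a => (f a - 1) / M with hd
  have hd0 : ∑ a, w a * d a = 0 := by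
    have (a : α) : w a * d a = (w a * f a - w a) / M := by rw [hd]; ring
    simp only [this, ← Finset.sum_div, Finset.sum_sub_distrib, hf1, hw]
    simp
  have hdb (a : α) : d a ^ 2 ≤ b ^ 2 := by
    rw [hd, hb, div_pow, div_pow]
    gcongr ?_ / _
    nlinarith [hf a, hfB a]
  set σ : ℝ := ∑ a, w a * d a ^ 2 with hσ
  have hσ0 : 0 ≤ σ := Finset.sum_nonneg fun a _ => mul_nonneg (hw0 a) (sq_nonneg _)
  have hd4 : ∑ a, w a * d a ^ 4 ≤ b ^ 2 * σ := by
    rw [hσ, Finset.mul_sum]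
    refine Finset.sum_le_sum fun a _ => ?_
    have := mul_le_mul_of_nonneg_left (hdb a) (mul_nonneg (hw0 a) (sq_nonneg (d a)))
    nlinarith
  have hv : (M : ℝ) * σ = 1 / M * ∑ a, w a * (f a - 1) ^ 2 := by
    rw [hσ, Finset.mul_sum, Finset.mul_sum]
    refine Finset.sum_congr rfl fun a _ => ?_
    rw [hd]
    field_simp
  have hvar : ∑ a, w a * (f a - 1) ^ 2 ≤ B := by
    have e (a : α) : w a * (f a - 1) ^ 2 ≤ B * (w a * f a) - 2 * (w a * f a) + w a := by
      have := mul_le_mul_of_nonneg_left (hfB a) (mul_nonneg (hw0 a) (hf a))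
      nlinarith
    refine (Finset.sum_le_sum fun a _ => e a).trans ?_
    rw [Finset.sum_add_distrib, Finset.sum_sub_distrib, ← Finset.mul_sum, ← Finset.mul_sum, hf1, hw]
    linarith
  have hvb : (M : ℝ) * σ ≤ b := by
    rw [hv, hb, one_div, div_eq_inv_mul]
    gcongr
  have hx (u : Fin M → α) : sampleMean f u = 1 + ∑ m, d (u m) := by
    simp only [sampleMean, hd, ← Finset.sum_div, Finset.sum_sub_distrib]
    simp
    field_simp
    ring
  have hpt (u : Fin M → α) :
      √(sampleMean f u) ≤ 1 + 1 / 2 * ∑ m, d (u m) -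
        1 / 18 * (c * (∑ m, d (u m)) ^ 2 - c ^ 2 / 4 * (∑ m, d (u m)) ^ 4) := by
    have h0 := sampleMean_nonneg hf u
    rw [hx] at h0 ⊢
    linarith [one_add_half_sub_sqrt_ge (x := ∑ m, d (u m)) (by linarith) hc1]
  have hmono := expIid_mono hw0 hpt
  simp only [expIid_sub, expIid_add, expIid_const_mul, expIid_const hw, expIid_sum_apply hw, hd0,
    expIid_sq_sum hw hd0, ← hσ] at hmono
  have h4 := expIid_pow_four_sum_le (M := M) hw hd0
  rw [← hσ] at h4
  have h5 : expIid M w (fun u => (∑ m, d (u m)) ^ 4) ≤ (M * σ) * (b ^ 2 + 3 * b) := by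
    have h6 : 0 ≤ (M : ℝ) * σ := by positivity
    nlinarith [mul_le_mul_of_nonneg_left hd4 hM0.le, mul_le_mul_of_nonneg_left hvb h6]
  have h7 : c ^ 2 / 4 * expIid M w (fun u => (∑ m, d (u m)) ^ 4) ≤ c / 2 * (M * σ) := by
    have h8 : c * (b ^ 2 + 3 * b) ≤ 2 := by
      rw [hc, one_div_mul_eq_div, div_le_iff₀ (by positivity)]
      nlinarith
    calc _ ≤ c ^ 2 / 4 * ((M * σ) * (b ^ 2 + 3 * b)) := by gcongr
      _ = c / 4 * (M * σ) * (c * (b ^ 2 + 3 * b)) := by ring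
      _ ≤ c / 4 * (M * σ) * 2 := by gcongr
      _ = _ := by ring
  have h9 : 1 / (36 * M * (1 + b) ^ 2) * ∑ a, w a * (f a - 1) ^ 2 = 1 / 36 * c * (M * σ) := by
    rw [hv, hc]
    field_simp
  rw [h9]
  linarith

/-- Replacing `f` outside of a set by its conditional mean there increases the mean of the square
root. -/
theorem sum_mul_sqrt_add_le (hw0 : ∀ a, 0 ≤ w a) (hf : ∀ a, 0 ≤ f a) (p : α → Prop)
    [DecidablePred p] {b : ℝ}
    (hb : ∑ a with ¬ p a, w a * f a = (∑ a with ¬ p a, w a) * b) {c : ℝ} (hc : 0 ≤ c) :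
    ∑ a, w a * √(f a + c) ≤ ∑ a, w a * √((if p a then f a else b) + c) := by
  rw [← Finset.sum_filter_add_sum_filter_not Finset.univ p,
    ← Finset.sum_filter_add_sum_filter_not Finset.univ p
      (f := fun a => w a * √((if p a then f a else b) + c))]
  refine add_le_add (le_of_eq (Finset.sum_congr rfl fun a ha => ?_)) ?_
  · rw [if_pos (Finset.mem_filter.1 ha).2]
  · have h1 : ∑ a with ¬ p a, w a * √((if p a then f a else b) + c) =
        (∑ a with ¬ p a, w a) * √(b + c) := by
      rw [Finset.sum_mul]
      exact Finset.sum_congr rfl fun a ha => by rw [if_neg (Finset.mem_filter.1 ha).2]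
    rw [h1]
    -- Jensen in the form of Cauchy–Schwarz, which also covers a complement of weight zero.
    have h2 := Real.sum_sqrt_mul_sqrt_le (Finset.univ.filter fun a => ¬ p a) (f := w)
      (g := fun a => w a * (f a + c)) hw0
      (fun a => mul_nonneg (hw0 a) (add_nonneg (hf a) hc))
    have h3 : ∑ a with ¬ p a, w a * (f a + c) = (∑ a with ¬ p a, w a) * (b + c) := by
      simp only [mul_add, Finset.sum_add_distrib, hb, Finset.sum_mul]
    have hp0 : 0 ≤ ∑ a with ¬ p a, w a := Finset.sum_nonneg fun a _ => hw0 a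
    rw [h3, Real.sqrt_mul hp0, ← mul_assoc, Real.mul_self_sqrt hp0] at h2
    refine le_trans (le_of_eq (Finset.sum_congr rfl fun a _ => ?_)) h2
    rw [Real.sqrt_mul (hw0 a), ← mul_assoc, Real.mul_self_sqrt (hw0 a)]

/-- Flattening `f` off the set `2 ≤ f ≤ B` to its mean `b` there only raises `E√T` and leaves a
function bounded by `B`, to which the moment bound applies. On the set, `(f - 1) ^ 2 ≥ f ^ 2 / 4`,
which turns 36 into 144. -/
theorem le_one_sub_expIid_sqrt_sampleMean (hw0 : ∀ a, 0 ≤ w a) (hw : ∑ a, w a = 1)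
    (hf : ∀ a, 0 ≤ f a) (hf1 : ∑ a, w a * f a = 1) (hM : M ≠ 0) {B : ℝ} (hB : 2 ≤ B) :
    1 / (144 * M * (1 + B / M) ^ 2) * ∑ a, w a * (if 2 ≤ f a ∧ f a ≤ B then f a ^ 2 else 0) ≤
      1 - expIid M w (fun u => √(sampleMean f u)) := by
  classical
  have hM0 : (0 : ℝ) < M := by positivity
  set p : α → Prop := fun a => 2 ≤ f a ∧ f a ≤ B with hp
  have hsplit := Finset.sum_filter_add_sum_filter_not Finset.univ p w
  have hsplitf := Finset.sum_filter_add_sum_filter_not Finset.univ p (fun a => w a * f a)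
  have hfp0 : 0 ≤ ∑ a with p a, w a * f a :=
    Finset.sum_nonneg fun a _ => mul_nonneg (hw0 a) (hf a)
  have hfn0 : 0 ≤ ∑ a with ¬ p a, w a * f a :=
    Finset.sum_nonneg fun a _ => mul_nonneg (hw0 a) (hf a)
  have hpw : 2 * ∑ a with p a, w a ≤ ∑ a with p a, w a * f a := by
    rw [Finset.mul_sum]
    refine Finset.sum_le_sum fun a ha => ?_
    have := mul_le_mul_of_nonneg_left (Finset.mem_filter.1 ha).2.1 (hw0 a)
    linarith
  set N := ∑ a with ¬ p a, w a with hN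
  -- Markov: `f` has mean one and is at least 2 on the set. Hence also `b ≤ 2 ≤ B`.
  have hN2 : 1 / 2 ≤ N := by linarith
  set b := (∑ a with ¬ p a, w a * f a) / N with hb
  have hNb : ∑ a with ¬ p a, w a * f a = N * b := by
    rw [hb]
    field_simp
  have hb0 : 0 ≤ b := div_nonneg hfn0 (by linarith)
  have hb2 : b ≤ 2 := by
    rw [hb, div_le_iff₀ (by linarith)]
    linarith
  set g : α → ℝ := fun a => if p a then f a else b with hg
  have hg0 (a : α) : 0 ≤ g a := by
    simp only [hg]
    split_ifs
    exacts [hf a, hb0]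
  have hgB (a : α) : g a ≤ B := by
    simp only [hg]
    split_ifs with h
    exacts [h.2, hb2.trans hB]
  have hg1 : ∑ a, w a * g a = 1 := by
    rw [← hf1, ← hsplitf, ← Finset.sum_filter_add_sum_filter_not Finset.univ p]
    congr 1
    · exact Finset.sum_congr rfl fun a ha => by
        simp only [hg, if_pos (Finset.mem_filter.1 ha).2]
    · rw [hNb, hN, Finset.sum_mul]
      exact Finset.sum_congr rfl fun a ha => by
        simp only [hg, if_neg (Finset.mem_filter.1 ha).2]
  have hj : expIid M w (fun u => √(sampleMean f u)) ≤ expIid M w (fun u => √(sampleMean g u)) := by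
    have := expIid_sqrt_sum_mono (M := M) hw0 hf hg0
      (fun c hc => sum_mul_sqrt_add_le hw0 hf p hNb hc) 0 le_rfl
    simp only [sampleMean, Real.sqrt_mul (show (0 : ℝ) ≤ 1 / M by positivity), expIid_const_mul]
    simp only [add_zero] at this
    gcongr
  have hmain := expIid_sqrt_sampleMean_le_of_bounded hw0 hw hg0 hg1 hM (by linarith) hgB
  refine le_trans ?_ (hmain.trans (by linarith))
  have e : 1 / (144 * (M : ℝ) * (1 + B / M) ^ 2) =
      1 / (36 * (M : ℝ) * (1 + B / M) ^ 2) * (1 / 4) := by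
    field_simp
    norm_num
  rw [e, mul_assoc]
  refine mul_le_mul_of_nonneg_left ?_ (by positivity)
  rw [Finset.mul_sum]
  refine Finset.sum_le_sum fun a _ => ?_
  rw [mul_left_comm]
  refine mul_le_mul_of_nonneg_left ?_ (hw0 a)
  simp only [hg, hp]
  split_ifs with h
  · nlinarith [h.1]
  · nlinarith [sq_nonneg (b - 1)]

end sampleMean

/-! ### Divergences through likelihood ratios -/

section ratio

variable {α : Type*} [Fintype α] {p T : α → ℝ}

/-- Jensen's inequality for the exponential function. -/
theorem exp_sum_le_sum_exp (hp0 : ∀ a, 0 ≤ p a) (hp : ∑ a, p a = 1) (F : α → ℝ) :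
    Real.exp (∑ a, p a * F a) ≤ ∑ a, p a * Real.exp (F a) := by
  simpa using convexOn_exp.map_sum_le (t := Finset.univ) (p := F) (fun a _ => hp0 a) hp
    (fun a _ => Set.mem_univ _)

/-- Jensen for the law `p T`, under which the right side is the mean of `exp (s log T)`. For either
sign of `s` it compares order `1 + s` with relative entropy. -/
theorem exp_mul_le_sum_rpow (hp0 : ∀ a, 0 ≤ p a) (hT : ∀ a, 0 ≤ T a) (hT1 : ∑ a, p a * T a = 1)
    {s : ℝ} (hs : -1 < s) :
    Real.exp (s * ∑ a, p a * (T a * Real.log (T a))) ≤ ∑ a, p a * T a ^ (1 + s) := by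
  have := exp_sum_le_sum_exp (p := fun a => p a * T a) (fun a => mul_nonneg (hp0 a) (hT a)) hT1
    (fun a => s * Real.log (T a))
  convert this using 1
  · congr 1
    rw [Finset.mul_sum]
    exact Finset.sum_congr rfl fun a _ => by ring
  · refine Finset.sum_congr rfl fun a _ => ?_
    rw [Real.rpow_one_add' (hT a) (by linarith), mul_assoc]
    rcases (hT a).eq_or_lt with h | h
    · simp [← h]
    · rw [Real.rpow_def_of_pos h, mul_comm s]

/-- Multiplying `log √T ≥ 1 - 1 / √T` by `2 T` gives `T log T ≥ 2 (T - √T)` pointwise. -/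
theorem two_mul_one_sub_sum_sqrt_le (hp0 : ∀ a, 0 ≤ p a) (hT : ∀ a, 0 ≤ T a)
    (hT1 : ∑ a, p a * T a = 1) :
    2 * (1 - ∑ a, p a * √(T a)) ≤ ∑ a, p a * (T a * Real.log (T a)) := by
  rw [← hT1, ← Finset.sum_sub_distrib, Finset.mul_sum]
  refine Finset.sum_le_sum fun a _ => ?_
  have : 2 * (T a - √(T a)) ≤ T a * Real.log (T a) := by
    rcases (hT a).eq_or_lt with h | h
    · simp [← h]
    · have hr : 0 < √(T a) := Real.sqrt_pos.2 h
      have h1 := Real.one_sub_inv_le_log_of_pos hr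
      rw [Real.log_sqrt h.le] at h1
      have h2 := mul_le_mul_of_nonneg_left h1 h.le
      have h3 : T a * (√(T a))⁻¹ = √(T a) := by
        rw [← div_eq_mul_inv, Real.div_sqrt]
      nlinarith
  nlinarith [mul_le_mul_of_nonneg_left this (hp0 a)]

/-- Both sides agree at `x = 1`, so a mean-one `T` leaves only a multiple of `1 - E√T`. For `1 + s ≤
1/2` the power is concave in `√x`; otherwise it is a weighted geometric mean of `√x` and `x`. -/
theorem exists_rpow_le_sqrt {s : ℝ} (hs : -1 < s) (hs0 : s < 0) :
    ∃ c d : ℝ, 0 < c ∧ ∀ x : ℝ, 0 ≤ x → x ^ (1 + s) ≤ c * √x + d * x + (1 - c - d) := by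
  rcases le_total (1 + s) (1 / 2) with h | h
  · refine ⟨2 * (1 + s), 0, by linarith, fun x hx => ?_⟩
    have := rpow_one_add_le_one_add_mul_self (s := √x - 1) (p := 2 * (1 + s))
      (by linarith [Real.sqrt_nonneg x]) (by linarith) (by linarith)
    rw [add_sub_cancel, Real.sqrt_eq_rpow, ← Real.rpow_mul hx, ← Real.sqrt_eq_rpow] at this
    rw [show (1 / 2 : ℝ) * (2 * (1 + s)) = 1 + s by ring] at this
    linarith
  · refine ⟨-2 * s, 1 + 2 * s, by linarith, fun x hx => ?_⟩
    have := Real.geom_mean_le_arith_mean2_weighted (w₁ := -2 * s) (w₂ := 1 + 2 * s) (by linarith)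
      (by linarith) (Real.sqrt_nonneg x) hx (by ring)
    have e : x ^ (1 + s) = √x ^ (-2 * s) * x ^ (1 + 2 * s) := by
      rw [Real.sqrt_eq_rpow, ← Real.rpow_mul hx, ← Real.rpow_add_of_nonneg hx (by linarith)
        (by linarith)]
      ring_nf
    rw [e]
    linarith

/-- The Rényi divergence of order `1 + s` between `p T` and `p`. -/
def ratioDiv (s : ℝ) (p T : α → ℝ) : ℝ :=
  if s = 0 then ∑ a, p a * (T a * Real.log (T a))
  else 1 / s * Real.log (∑ a, p a * T a ^ (1 + s))

theorem renyiDiv_eq_ratioDiv {A Q : α → ℝ} (hQ : ∀ a, 0 ≤ Q a) (hT : ∀ a, 0 ≤ T a)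
    (hA : ∀ a, A a = Q a * T a) {s : ℝ} (hs : -1 < s) : renyiDiv s A Q = ratioDiv s Q T := by
  rw [renyiDiv, ratioDiv, relEntropy]
  split_ifs with h
  · refine Finset.sum_congr rfl fun a _ => ?_
    rw [hA]
    rcases (hQ a).eq_or_lt with h0 | h0
    · simp [← h0]
    · rw [mul_div_cancel_left₀ _ h0.ne', mul_assoc]
  · congr 2
    refine Finset.sum_congr rfl fun a _ => ?_
    rw [hA]
    rcases (hQ a).eq_or_lt with h0 | h0
    · simp [← h0, Real.zero_rpow (by linarith : 1 + s ≠ 0)]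
    · rw [Real.mul_rpow h0.le (hT a), mul_right_comm, ← Real.rpow_add h0]
      simp

/-- One lower bound for all orders. The constant precedes the alphabet because the alphabet grows
with the blocklength. -/
theorem mul_one_sub_sum_sqrt_le_ratioDiv {s : ℝ} (hs : -1 < s) :
    ∃ c : ℝ, 0 < c ∧ ∀ {α : Type _} [Fintype α] {p T : α → ℝ}, (∀ a, 0 ≤ p a) → ∑ a, p a = 1 →
      (∀ a, 0 ≤ T a) → ∑ a, p a * T a = 1 →
      c * (1 - ∑ a, p a * √(T a)) ≤ ratioDiv s p T := by
  rcases lt_trichotomy s 0 with h | h | h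
  · obtain ⟨c, d, hc, hcd⟩ := exists_rpow_le_sqrt hs h
    refine ⟨-(1 / s) * c, mul_pos (by simpa using h) hc, fun {α} _ p T hp0 hp hT hT1 => ?_⟩
    have hZ : ∑ a, p a * T a ^ (1 + s) ≤ 1 - c * (1 - ∑ a, p a * √(T a)) := by
      refine (Finset.sum_le_sum fun a _ =>
        mul_le_mul_of_nonneg_left (hcd (T a) (hT a)) (hp0 a)).trans_eq ?_
      have e (a : α) : p a * (c * √(T a) + d * T a + (1 - c - d)) =
          c * (p a * √(T a)) + d * (p a * T a) + (1 - c - d) * p a := by ring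
      simp only [e, Finset.sum_add_distrib, ← Finset.mul_sum, hp, hT1]
      ring
    have hZ0 := (Real.exp_pos _).trans_le (exp_mul_le_sum_rpow hp0 hT hT1 hs)
    have hlog := Real.log_le_sub_one_of_pos hZ0
    rw [ratioDiv, if_neg h.ne]
    have hs' : 1 / s ≤ 0 := by simpa using h.le
    have := mul_le_mul_of_nonpos_left (hlog.trans (sub_le_sub_right hZ 1)) hs'
    refine le_trans (le_of_eq ?_) this
    ring
  · subst h
    refine ⟨2, two_pos, fun {α} _ p T hp0 _ hT hT1 => ?_⟩
    simpa [ratioDiv] using two_mul_one_sub_sum_sqrt_le hp0 hT hT1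
  · refine ⟨2, two_pos, fun {α} _ p T hp0 _ hT hT1 => ?_⟩
    refine (two_mul_one_sub_sum_sqrt_le hp0 hT hT1).trans ?_
    have h1 := exp_mul_le_sum_rpow hp0 hT hT1 hs
    rw [← Real.le_log_iff_exp_le ((Real.exp_pos _).trans_le h1)] at h1
    rwa [ratioDiv, if_neg h.ne', one_div, ← div_eq_inv_mul, le_div_iff₀ h, mul_comm]

theorem ratioDiv_le_of_nonpos (hp0 : ∀ a, 0 ≤ p a) (hT : ∀ a, 0 ≤ T a)
    (hT1 : ∑ a, p a * T a = 1) {s : ℝ} (hs : -1 < s) (hs0 : s ≤ 0) :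
    ratioDiv s p T ≤ ∑ a, p a * (T a * Real.log (T a)) := by
  rw [ratioDiv]
  split_ifs with h
  · rfl
  · have h1 := exp_mul_le_sum_rpow hp0 hT hT1 hs
    rw [← Real.le_log_iff_exp_le ((Real.exp_pos _).trans_le h1)] at h1
    rw [one_div, ← div_eq_inv_mul, div_le_iff_of_neg (lt_of_le_of_ne hs0 h), mul_comm]
    exact h1

theorem ratioDiv_le_of_pos {s z : ℝ} (hs0 : 0 < s) (hz : ∑ a, p a * T a ^ (1 + s) ≤ 1 + z)
    (h1 : 0 < ∑ a, p a * T a ^ (1 + s)) : ratioDiv s p T ≤ 1 / s * z := by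
  rw [ratioDiv, if_neg hs0.ne']
  have := Real.log_le_sub_one_of_pos h1
  gcongr
  linarith

theorem le_ratioDiv_of_pos {s z : ℝ} (hs0 : 0 < s) (hz0 : 0 ≤ z) (hz1 : z ≤ 1)
    (hz : 1 + z ≤ ∑ a, p a * T a ^ (1 + s)) : 1 / s * (z / 2) ≤ ratioDiv s p T := by
  rw [ratioDiv, if_neg hs0.ne']
  have h1 := Real.one_sub_inv_le_log_of_pos (by linarith : 0 < 1 + z)
  have h2 := Real.log_le_log (by linarith) hz
  have h3 : z / 2 ≤ 1 - (1 + z)⁻¹ := by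
    have : (1 + z)⁻¹ * (1 + z) = 1 := inv_mul_cancel₀ (by linarith)
    have : (1 + z)⁻¹ ≤ 1 - z / 2 := by
      rw [inv_le_iff_one_le_mul₀ (by linarith)]
      nlinarith
    linarith
  gcongr
  linarith

end ratio

/-! ### One-shot bounds for random codes -/

section oneShot

variable {α β : Type*} [Fintype α] [Fintype β] {M : ℕ} {w : α → ℝ} {q : β → ℝ} {L : α → β → ℝ}

theorem prodDist_mem_stdSimplex (hw : w ∈ stdSimplex ℝ α) (hq : q ∈ stdSimplex ℝ β) :
    prodDist w q ∈ stdSimplex ℝ (α × β) := by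
  refine ⟨fun z => mul_nonneg (hw.1 _) (hq.1 _), ?_⟩
  simp only [prodDist, Fintype.sum_prod_type]
  rw [← Fintype.sum_mul_sum, hw.2, hq.2, one_mul]

/-- The density of the output of a random code: the mean over the codebook of the likelihood
ratios `L · y`. -/
def codeRatio (M : ℕ) (L : α → β → ℝ) : β × (Fin M → α) → ℝ :=
  fun z => sampleMean (fun a => L a z.1) z.2

theorem sum_prodDist_codeRatio (F : ℝ → ℝ) :
    ∑ z, prodDist q (iidDist M w) z * F (codeRatio M L z) =
      ∑ y, q y * expIid M w (fun u => F (sampleMean (fun a => L a y) u)) := by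
  simp only [Fintype.sum_prod_type, prodDist, codeRatio, expIid, Finset.mul_sum, mul_assoc]

theorem sum_prodDist_mul_codeRatio (hw : ∑ a, w a = 1) (hq : ∑ y, q y = 1)
    (hL1 : ∀ y, q y ≠ 0 → ∑ a, w a * L a y = 1) (hM : M ≠ 0) :
    ∑ z, prodDist q (iidDist M w) z * codeRatio M L z = 1 := by
  rw [sum_prodDist_codeRatio (fun x => x), ← hq]
  refine Finset.sum_congr rfl fun y _ => ?_
  by_cases h : q y = 0
  · simp [h]
  · rw [expIid_sampleMean hw hM, hL1 y h, mul_one]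

theorem sum_mul_le_sum_mul_of_ne_zero (hq0 : ∀ y, 0 ≤ q y) {F G : β → ℝ}
    (h : ∀ y, q y ≠ 0 → F y ≤ G y) : ∑ y, q y * F y ≤ ∑ y, q y * G y := by
  refine Finset.sum_le_sum fun y _ => ?_
  by_cases h0 : q y = 0
  · simp [h0]
  · exact mul_le_mul_of_nonneg_left (h y h0) (hq0 y)

/-- For `s ≤ 0` the bound passes through relative entropy and forgets `s`, which is why the exponent
is then the same for all such `s`. -/
theorem ratioDiv_codeRatio_le (hw : w ∈ stdSimplex ℝ α) (hq : q ∈ stdSimplex ℝ β)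
    (hL : ∀ a y, 0 ≤ L a y) (hL1 : ∀ y, q y ≠ 0 → ∑ a, w a * L a y = 1) (hM : M ≠ 0)
    {s t : ℝ} (hs : -1 < s) (hst : s ≤ t) (ht0 : 0 < t) (ht : t ≤ 1) :
    ratioDiv s (prodDist q (iidDist M w)) (codeRatio M L) ≤
      (if 0 < s then 1 / s else 1 / t) *
        ((M : ℝ) ^ (-t) * ∑ y, q y * ∑ a, w a * L a y ^ (1 + t)) := by
  have hp := prodDist_mem_stdSimplex hq (iidDist_mem_stdSimplex (M := M) hw)
  have hT (z : β × (Fin M → α)) : 0 ≤ codeRatio M L z := sampleMean_nonneg (fun a => hL a _) _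
  have hT1 := sum_prodDist_mul_codeRatio hw.2 hq.2 hL1 hM
  split_ifs with h0
  · have h1 : ∑ z, prodDist q (iidDist M w) z * codeRatio M L z ^ (1 + s) ≤
        1 + (M : ℝ) ^ (-t) * ∑ y, q y * ∑ a, w a * L a y ^ (1 + t) := by
      rw [sum_prodDist_codeRatio (fun x => x ^ (1 + s))]
      refine (sum_mul_le_sum_mul_of_ne_zero hq.1 fun y hy => expIid_sampleMean_rpow_le hw.1 hw.2
        (fun a => hL a y) (hL1 y hy) hM h0 hst ht).trans_eq ?_
      simp only [mul_add, mul_one, Finset.sum_add_distrib, hq.2, Finset.mul_sum, mul_left_comm]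
    exact ratioDiv_le_of_pos h0 h1
      ((Real.exp_pos _).trans_le (exp_mul_le_sum_rpow hp.1 hT hT1 hs))
  · refine (ratioDiv_le_of_nonpos hp.1 hT hT1 hs (not_lt.1 h0)).trans ?_
    rw [sum_prodDist_codeRatio (fun x => x * Real.log x)]
    refine (sum_mul_le_sum_mul_of_ne_zero hq.1 fun y hy => expIid_sampleMean_mul_log_le hw.1 hw.2
        (fun a => hL a y) (hL1 y hy) hM ht0 ht).trans_eq ?_
    simp only [Finset.mul_sum, mul_left_comm]

theorem le_ratioDiv_codeRatio {s : ℝ} (hs : -1 < s) :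
    ∃ c : ℝ, 0 < c ∧ ∀ {α : Type _} {β : Type _} [Fintype α] [Fintype β] {M : ℕ} {w : α → ℝ}
      {q : β → ℝ} {L : α → β → ℝ}, w ∈ stdSimplex ℝ α → q ∈ stdSimplex ℝ β →
      (∀ a y, 0 ≤ L a y) → (∀ y, q y ≠ 0 → ∑ a, w a * L a y = 1) → M ≠ 0 → ∀ B : ℝ, 2 ≤ B →
      c / (M * (1 + B / M) ^ 2) *
          ∑ y, q y * ∑ a, w a * (if 2 ≤ L a y ∧ L a y ≤ B then L a y ^ 2 else 0) ≤
        ratioDiv s (prodDist q (iidDist M w)) (codeRatio M L) := by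
  obtain ⟨c, hc, h⟩ := mul_one_sub_sum_sqrt_le_ratioDiv hs
  refine ⟨c / 144, by positivity, fun {α β} _ _ {M w q L} hw hq hL hL1 hM B hB => ?_⟩
  have hp := prodDist_mem_stdSimplex hq (iidDist_mem_stdSimplex (M := M) hw)
  refine le_trans ?_ (h hp.1 hp.2 (fun z => sampleMean_nonneg (fun a => hL a _) _)
    (sum_prodDist_mul_codeRatio hw.2 hq.2 hL1 hM))
  rw [sum_prodDist_codeRatio (fun x => √x)]
  have h1 := sum_mul_le_sum_mul_of_ne_zero hq.1 fun y hy => le_one_sub_expIid_sqrt_sampleMean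
    hw.1 hw.2 (fun a => hL a y) (hL1 y hy) hM hB
  simp only [mul_sub, mul_one, Finset.sum_sub_distrib, hq.2] at h1
  refine le_trans (le_of_eq ?_) (mul_le_mul_of_nonneg_left h1 hc.le |>.trans_eq (by ring))
  simp only [mul_left_comm (q _), ← Finset.mul_sum]
  have hM0 : (0 : ℝ) < M := by positivity
  field_simp

theorem le_ratioDiv_codeRatio_of_pos (hw : w ∈ stdSimplex ℝ α) (hq : q ∈ stdSimplex ℝ β)
    (hL : ∀ a y, 0 ≤ L a y) (hL1 : ∀ y, q y ≠ 0 → ∑ a, w a * L a y = 1) (hM : M ≠ 0)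
    {s z : ℝ} (hs : 0 < s) (hz0 : 0 ≤ z) (hz1 : z ≤ 1)
    (hz : z ≤ (1 - (2 + s) / 2 ^ (1 + s)) * ((M : ℝ) ^ (-s) *
      ∑ y, q y * ∑ a, w a * if 2 * M ≤ L a y then L a y ^ (1 + s) else 0)) :
    1 / s * (z / 2) ≤ ratioDiv s (prodDist q (iidDist M w)) (codeRatio M L) := by
  refine le_ratioDiv_of_pos hs hz0 hz1 ((add_le_add_right hz 1).trans ?_)
  rw [sum_prodDist_codeRatio (fun x => x ^ (1 + s))]
  refine le_trans (le_of_eq ?_) (sum_mul_le_sum_mul_of_ne_zero hq.1 fun y hy =>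
    le_expIid_sampleMean_rpow hw.1 hw.2 (fun a => hL a y) (hL1 y hy) hM hs)
  simp only [mul_add, mul_one, Finset.sum_add_distrib, hq.2, Finset.mul_sum, mul_left_comm]

end oneShot

/-! ### Likelihood ratios of memoryless channels -/

section channel

variable {𝒳 𝒴 : Type*}

/-- The likelihood ratio `P_{Y|X}(y|x) / Q_Y(y)`. -/
def likelihoodRatio (W : 𝒳 → 𝒴 → ℝ) (Q : 𝒴 → ℝ) : 𝒳 × 𝒴 → ℝ :=
  fun z => W z.1 z.2 / Q z.2

variable [Fintype 𝒳] [Fintype 𝒴] {W : 𝒳 → 𝒴 → ℝ} {P : 𝒳 → ℝ} {Q : 𝒴 → ℝ}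

theorem output_mem_stdSimplex (hW : ∀ x, W x ∈ stdSimplex ℝ 𝒴) (hP : P ∈ inducing W Q) :
    Q ∈ stdSimplex ℝ 𝒴 := by
  obtain ⟨hP1, rfl⟩ := hP
  refine ⟨fun y => Finset.sum_nonneg fun x _ => mul_nonneg ((hW x).1 y) (hP1.1 x), ?_⟩
  simp only [outputDist]
  rw [Finset.sum_comm]
  simp only [← Finset.sum_mul, (hW _).2, one_mul, hP1.2]

omit [Fintype 𝒳] in
theorem likelihoodRatio_nonneg (hW : ∀ x, W x ∈ stdSimplex ℝ 𝒴) (hQ : Q ∈ stdSimplex ℝ 𝒴)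
    (z : 𝒳 × 𝒴) : 0 ≤ likelihoodRatio W Q z :=
  div_nonneg ((hW _).1 _) (hQ.1 _)

/-- Where `Q` vanishes the quotient is 0 by convention; absolute continuity makes both sides zero
there. -/
theorem jointDist_eq_prodDist_mul (hW : ∀ x, W x ∈ stdSimplex ℝ 𝒴) (hP : P ∈ inducing W Q)
    (z : 𝒳 × 𝒴) : jointDist P W z = prodDist P Q z * likelihoodRatio W Q z := by
  by_cases h : prodDist P Q z = 0
  · rw [jointDist_absolutelyContinuous hW hP z h, h, zero_mul]
  · have : Q z.2 ≠ 0 := right_ne_zero_of_mul h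
    rw [jointDist, prodDist, likelihoodRatio]
    field_simp

theorem codeJoint_eq_prodDist_mul (hW : ∀ x, W x ∈ stdSimplex ℝ 𝒴) (hP : P ∈ inducing W Q)
    (n M : ℕ) (z : (Fin n → 𝒴) × Codebook 𝒳 n M) :
    codeJoint n M P W z = prodDist (iidDist n Q) (codebookDist n M P) z *
      codeRatio M (fun x y => ∏ i, likelihoodRatio W Q (x i, y i)) z := by
  by_cases h : prodDist (iidDist n Q) (codebookDist n M P) z = 0
  · rw [codeJoint_absolutelyContinuous hW hP n M z h, h, zero_mul]
  · have hQ : ∏ i, Q (z.1 i) ≠ 0 := left_ne_zero_of_mul h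
    simp only [codeJoint, prodDist, codeOutput, codeRatio, sampleMean, likelihoodRatio, iidDist,
      Finset.prod_div_distrib, ← Finset.sum_div]
    field_simp

omit [Fintype 𝒴] in
-- The code's input law induces exactly `Q`, so the ratio has mean one at each output of positive
-- probability.
theorem sum_iidDist_mul_likelihoodRatio (hP : P ∈ inducing W Q) (n : ℕ) (y : Fin n → 𝒴)
    (hy : iidDist n Q y ≠ 0) :
    ∑ x, iidDist n P x * ∏ i, likelihoodRatio W Q (x i, y i) = 1 := by
  have h := sum_prod_apply (M := n) fun i x => P x * likelihoodRatio W Q (x, y i)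
  simp only [Finset.prod_mul_distrib] at h
  refine h.trans (Finset.prod_eq_one fun i _ => ?_)
  have hQ : Q (y i) ≠ 0 := fun h0 => hy (Finset.prod_eq_zero (Finset.mem_univ i) h0)
  have hQ' : ∑ x, W x (y i) * P x = Q (y i) := congrFun hP.2 (y i)
  rw [← div_self hQ, ← hQ', Finset.sum_div]
  exact Finset.sum_congr rfl fun x _ => by simp only [likelihoodRatio]; rw [hQ']; ring

theorem iidResolvability_eq_ratioDiv (hW : ∀ x, W x ∈ stdSimplex ℝ 𝒴) (hP : P ∈ inducing W Q)
    {s : ℝ} (hs : -1 < s) (n M : ℕ) :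
    iidResolvability s n M P W Q = ratioDiv s (prodDist (iidDist n Q) (iidDist M (iidDist n P)))
      (codeRatio M fun x y => ∏ i, likelihoodRatio W Q (x i, y i)) := by
  have hQ := output_mem_stdSimplex hW hP
  refine renyiDiv_eq_ratioDiv
    (prodDist_mem_stdSimplex (iidDist_mem_stdSimplex hQ)
      (iidDist_mem_stdSimplex (iidDist_mem_stdSimplex hP.1))).1
    (fun z => sampleMean_nonneg
      (fun x => Finset.prod_nonneg fun i _ => likelihoodRatio_nonneg hW hQ _) _)
    (codeJoint_eq_prodDist_mul hW hP n M) hs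

theorem sum_iidDist_prod (n : ℕ) (ℓ : 𝒳 × 𝒴 → ℝ)
    (F : ℝ → ℝ) :
    ∑ y, iidDist n Q y * ∑ x, iidDist n P x * F (∏ i, ℓ (x i, y i)) =
      expIid n (prodDist P Q) (fun z => F (∏ i, ℓ (z i))) := by
  rw [expIid, ← (Equiv.arrowProdEquivProdArrow (Fin n) (fun _ => 𝒳) (fun _ => 𝒴)).symm.sum_comp,
    Fintype.sum_prod_type, Finset.sum_comm]
  refine Finset.sum_congr rfl fun x _ => ?_
  rw [Finset.mul_sum]
  refine Finset.sum_congr rfl fun y _ => ?_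
  simp [iidDist, prodDist, Finset.prod_mul_distrib, Equiv.arrowProdEquivProdArrow]
  ring

end channel

/-! ### Exponential tilting -/

section tilting

variable {γ : Type*} [Fintype γ]

/-- Chebyshev's inequality for independent samples. -/
theorem eventually_half_le_expIid {ρ : γ → ℝ} (hρ : ρ ∈ stdSimplex ℝ γ) (Λ : γ → ℝ) {δ : ℝ}
    (hδ : 0 < δ) : ∀ᶠ n : ℕ in atTop, 1 / 2 ≤ expIid n ρ (fun z =>
      if |∑ i, Λ (z i) - n * ∑ a, ρ a * Λ a| ≤ n * δ then 1 else 0) := by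
  set μ := ∑ a, ρ a * Λ a with hμ
  set σ := ∑ a, ρ a * (Λ a - μ) ^ 2 with hσ
  have hd : ∑ a, ρ a * (Λ a - μ) = 0 := by
    simp [mul_sub, Finset.sum_sub_distrib, ← Finset.sum_mul, hρ.2, hμ]
  obtain ⟨N, hN⟩ := exists_nat_ge (2 * σ / δ ^ 2)
  filter_upwards [eventually_ge_atTop (N + 1)] with n hn
  have hn0 : (0 : ℝ) < n := by
    have : 0 < n := by omega
    positivity
  have hpt (z : Fin n → γ) : 1 - (1 / (n * δ) ^ 2) * (∑ i, (Λ (z i) - μ)) ^ 2 ≤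
      if |∑ i, Λ (z i) - n * μ| ≤ n * δ then (1 : ℝ) else 0 := by
    have e : ∑ i, (Λ (z i) - μ) = ∑ i, Λ (z i) - n * μ := by simp [Finset.sum_sub_distrib]
    rw [e]
    split_ifs with h
    · have : 0 ≤ 1 / (n * δ) ^ 2 * (∑ i, Λ (z i) - n * μ) ^ 2 := by positivity
      linarith
    · rw [sub_nonpos, one_div_mul_eq_div, one_le_div (by positivity), ← sq_abs (_ - _)]
      push Not at h
      gcongr
  refine le_trans ?_ (expIid_mono hρ.1 hpt)
  rw [expIid_sub, expIid_const_mul, expIid_const hρ.2, expIid_sq_sum hρ.2 hd, ← hσ]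
  have h1 : 2 * σ ≤ n * δ ^ 2 := by
    rw [div_le_iff₀ (by positivity)] at hN
    have : (N : ℝ) ≤ n := by exact_mod_cast (by omega : N ≤ n)
    nlinarith [sq_nonneg δ]
  have h2 : 1 / (n * δ) ^ 2 * (n * σ) ≤ 1 / 2 := by
    rw [one_div_mul_eq_div, div_le_iff₀ (by positivity)]
    nlinarith
  linarith

/-- The partition function `∑ p exp(t log ℓ)`. -/
def partition (p ℓ : γ → ℝ) (t : ℝ) : ℝ :=
  ∑ a, p a * Real.exp (t * Real.log (ℓ a))

/-- The distribution `p` tilted by `ℓ ^ t`. -/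
def tilted (p ℓ : γ → ℝ) (t : ℝ) (a : γ) : ℝ :=
  p a * Real.exp (t * Real.log (ℓ a)) / partition p ℓ t

variable {p ℓ : γ → ℝ}

theorem partition_pos (hp : p ∈ stdSimplex ℝ γ) (t : ℝ) : 0 < partition p ℓ t := by
  refine (Real.exp_pos _).trans_le (exp_sum_le_sum_exp hp.1 hp.2 _)

theorem tilted_mem_stdSimplex (hp : p ∈ stdSimplex ℝ γ) (t : ℝ) :
    tilted p ℓ t ∈ stdSimplex ℝ γ := by
  have h := partition_pos (ℓ := ℓ) hp t
  refine ⟨fun a => div_nonneg (mul_nonneg (hp.1 a) (Real.exp_pos _).le) h.le, ?_⟩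
  simp only [tilted, ← Finset.sum_div]
  exact div_self h.ne'

omit [Fintype γ] in
-- At `ℓ a = 0` the convention `log 0 = 0` makes the exponential 1, but `p a` vanishes. The
-- exponential form is continuous in every real `t`.
theorem mul_rpow_eq_mul_exp {π : γ → ℝ} (hℓ : ∀ a, 0 ≤ ℓ a) (hpπ : ∀ a, p a = π a * ℓ a) {t : ℝ}
    (ht : 0 ≤ t) (a : γ) : π a * ℓ a ^ (1 + t) = p a * Real.exp (t * Real.log (ℓ a)) := by
  rw [hpπ, Real.rpow_one_add' (hℓ a) (by linarith)]
  rcases (hℓ a).eq_or_lt with h | h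
  · simp [← h]
  · rw [Real.rpow_def_of_pos h, mul_comm t, mul_assoc]

theorem sum_mul_rpow_eq_partition {π : γ → ℝ} (hℓ : ∀ a, 0 ≤ ℓ a) (hpπ : ∀ a, p a = π a * ℓ a)
    {t : ℝ} (ht : 0 ≤ t) : ∑ a, π a * ℓ a ^ (1 + t) = partition p ℓ t :=
  Finset.sum_congr rfl fun a _ => mul_rpow_eq_mul_exp hℓ hpπ ht a

theorem iidDist_mul_rpow_eq {π : γ → ℝ} (hp : p ∈ stdSimplex ℝ γ) (hℓ : ∀ a, 0 ≤ ℓ a)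
    (hpπ : ∀ a, p a = π a * ℓ a) {t : ℝ} (ht : 0 ≤ t) (n : ℕ) (z : Fin n → γ) :
    iidDist n π z * (∏ i, ℓ (z i)) ^ (1 + t) =
      partition p ℓ t ^ n * iidDist n (tilted p ℓ t) z := by
  rw [iidDist, ← Real.finsetProd_rpow _ _ fun i _ => hℓ _, ← Finset.prod_mul_distrib, iidDist]
  simp only [mul_rpow_eq_mul_exp hℓ hpπ ht, tilted, Finset.prod_div_distrib, Finset.prod_const,
    Finset.card_univ, Fintype.card_fin]
  have := (partition_pos (ℓ := ℓ) hp t).ne'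
  field_simp

theorem expIid_prod_rpow {π : γ → ℝ} (hp : p ∈ stdSimplex ℝ γ) (hℓ : ∀ a, 0 ≤ ℓ a)
    (hpπ : ∀ a, p a = π a * ℓ a) {t : ℝ} (ht : 0 ≤ t) (n : ℕ) :
    expIid n π (fun z => (∏ i, ℓ (z i)) ^ (1 + t)) = partition p ℓ t ^ n := by
  simp only [expIid, iidDist_mul_rpow_eq hp hℓ hpπ ht, ← Finset.mul_sum,
    sum_iidDist (tilted_mem_stdSimplex hp t).2, mul_one]

/-- Once `partition p ℓ t ^ n` is factored out, the tilted product law remains, and Chebyshev gives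
the window around `e^{nμ}` at least half of its mass. -/
theorem eventually_half_partition_le_expIid {π : γ → ℝ} (hp : p ∈ stdSimplex ℝ γ)
    (hℓ : ∀ a, 0 ≤ ℓ a) (hpπ : ∀ a, p a = π a * ℓ a) {t : ℝ} (ht : 0 ≤ t) {μ δ : ℝ}
    (hμ : ∑ a, tilted p ℓ t a * Real.log (ℓ a) = μ) (hδ : 0 < δ) :
    ∀ᶠ n : ℕ in atTop, 1 / 2 * partition p ℓ t ^ n ≤ expIid n π (fun z =>
      if Real.exp (n * (μ - δ)) ≤ ∏ i, ℓ (z i) ∧ ∏ i, ℓ (z i) ≤ Real.exp (n * (μ + δ))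
      then (∏ i, ℓ (z i)) ^ (1 + t) else 0) := by
  have hZ := partition_pos (ℓ := ℓ) hp t
  filter_upwards [eventually_half_le_expIid (tilted_mem_stdSimplex (ℓ := ℓ) hp t)
    (fun a => Real.log (ℓ a)) hδ] with n hn
  rw [hμ] at hn
  rw [mul_comm]
  refine (mul_le_mul_of_nonneg_left hn (pow_pos hZ n).le).trans ?_
  simp only [expIid, Finset.mul_sum]
  refine Finset.sum_le_sum fun z _ => ?_
  rw [← mul_assoc, ← iidDist_mul_rpow_eq hp hℓ hpπ ht]
  -- With `log 0 = 0` such a `z` may fall in the logarithmic window, but it carries no weight.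
  by_cases h0 : ∏ i, ℓ (z i) = 0
  · rw [h0, Real.zero_rpow (by linarith)]
    simp
  have hpos : 0 < ∏ i, ℓ (z i) := lt_of_le_of_ne (Finset.prod_nonneg fun i _ => hℓ _) (Ne.symm h0)
  have hlog : Real.log (∏ i, ℓ (z i)) = ∑ i, Real.log (ℓ (z i)) :=
    Real.log_prod fun i hi => (Finset.prod_ne_zero_iff.1 h0) i hi
  have hiff : |∑ i, Real.log (ℓ (z i)) - n * μ| ≤ n * δ ↔
      Real.exp (n * (μ - δ)) ≤ ∏ i, ℓ (z i) ∧ ∏ i, ℓ (z i) ≤ Real.exp (n * (μ + δ)) := by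
    rw [← Real.le_log_iff_exp_le hpos, ← Real.log_le_iff_le_exp hpos, hlog, abs_le]
    constructor <;> rintro ⟨h1, h2⟩ <;> constructor <;> linarith
  simp only [hiff]
  split_ifs <;> simp

end tilting

/-! ### Exponents -/

theorem eventually_le_exp_mul (c : ℝ) {ε : ℝ} (hε : 0 < ε) :
    ∀ᶠ n : ℕ in atTop, c ≤ Real.exp (n * ε) :=
  (Real.tendsto_exp_atTop.comp
    (tendsto_natCast_atTop_atTop.atTop_mul_const hε)).eventually_ge_atTop c

theorem eventually_exp_neg_mul_le {c ε : ℝ} (hc : 0 < c) (hε : 0 < ε) :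
    ∀ᶠ n : ℕ in atTop, Real.exp (-(n * ε)) ≤ c := by
  filter_upwards [eventually_le_exp_mul (1 / c) hε] with n hn
  rw [Real.exp_neg, inv_le_comm₀ (Real.exp_pos _) hc, ← one_div]
  exact hn

theorem eventually_rate {M : ℕ → ℕ} {R : ℝ} (hR : 0 < R)
    (hM : Tendsto (fun n : ℕ => Real.log (M n) / n) atTop (𝓝 R)) {ε : ℝ} (hε : 0 < ε) :
    ∀ᶠ n : ℕ in atTop, M n ≠ 0 ∧ Real.exp (n * (R - ε)) ≤ M n ∧
      (M n : ℝ) ≤ Real.exp (n * (R + ε)) := by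
  filter_upwards [hM.eventually (lt_mem_nhds hR),
    hM.eventually (lt_mem_nhds (sub_lt_self R hε)),
    hM.eventually (gt_mem_nhds (lt_add_of_pos_right R hε)), eventually_gt_atTop 0]
    with n h0 h1 h2 hn
  have hn0 : (0 : ℝ) < n := by exact_mod_cast hn
  -- As `log 0 = 0`, a positive value of `log (M n) / n` excludes an empty codebook.
  have hM0 : M n ≠ 0 := fun h => by simp [h] at h0
  have hM1 : (0 : ℝ) < M n := by positivity
  rw [lt_div_iff₀ hn0, mul_comm] at h1
  rw [div_lt_iff₀ hn0, mul_comm] at h2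
  exact ⟨hM0, (Real.le_log_iff_exp_le hM1).1 h1.le, (Real.log_le_iff_le_exp hM1).1 h2.le⟩

theorem tendsto_exponent {D : ℕ → ℝ} {E : ℝ}
    (hlo : ∀ ε, 0 < ε → ∀ᶠ n : ℕ in atTop, Real.exp (-(n * (E + ε))) ≤ D n)
    (hup : ∀ ε, 0 < ε → ∀ᶠ n : ℕ in atTop, D n ≤ Real.exp (-(n * (E - ε)))) :
    (∀ᶠ n : ℕ in atTop, 0 < D n) ∧
      Tendsto (fun n : ℕ => -(1 / (n : ℝ)) * Real.log (D n)) atTop (𝓝 E) := by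
  refine ⟨(hlo 1 one_pos).mono fun n h => (Real.exp_pos _).trans_le h, ?_⟩
  rw [Metric.tendsto_nhds]
  intro ε hε
  filter_upwards [hlo (ε / 2) (by linarith), hup (ε / 2) (by linarith), eventually_gt_atTop 0]
    with n h1 h2 hn
  have hn0 : (0 : ℝ) < n := by exact_mod_cast hn
  have hD : 0 < D n := (Real.exp_pos _).trans_le h1
  rw [← Real.le_log_iff_exp_le hD] at h1
  rw [← Real.log_le_iff_le_exp hD] at h2
  have e : -(1 / (n : ℝ)) * Real.log (D n) = -Real.log (D n) / n := by ring
  have h3 : -Real.log (D n) / n ≤ E + ε / 2 := by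
    rw [div_le_iff₀ hn0]
    linarith
  have h4 : E - ε / 2 ≤ -Real.log (D n) / n := by
    rw [le_div_iff₀ hn0]
    linarith
  rw [Real.dist_eq, e, abs_lt]
  constructor <;> linarith

theorem rpow_exp_mul (x y : ℝ) : Real.exp x ^ y = Real.exp (x * y) := by
  rw [Real.exp_mul]

theorem pow_eq_exp_mul_log {z : ℝ} (hz : 0 < z) (n : ℕ) : z ^ n = Real.exp (n * Real.log z) := by
  rw [Real.exp_nat_mul, Real.exp_log hz]

/-! ### Exponential upper and lower bounds for the resolvability measure. -/

section channel

variable {𝒳 𝒴 : Type*} [Fintype 𝒳] [Fintype 𝒴] {W : 𝒳 → 𝒴 → ℝ} {P : 𝒳 → ℝ} {Q : 𝒴 → ℝ}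

theorem jointDist_mem_stdSimplex (hW : ∀ x, W x ∈ stdSimplex ℝ 𝒴) (hP : P ∈ stdSimplex ℝ 𝒳) :
    jointDist P W ∈ stdSimplex ℝ (𝒳 × 𝒴) := by
  refine ⟨fun z => mul_nonneg (hP.1 _) ((hW _).1 _), ?_⟩
  simp only [jointDist, Fintype.sum_prod_type, ← Finset.mul_sum, (hW _).2, mul_one, hP.2]

/-- The cumulant generating function `t D_{1+t}(P_{XY}‖P_X × Q_Y)` of the information density. -/
def infoCgf (P : 𝒳 → ℝ) (W : 𝒳 → 𝒴 → ℝ) (Q : 𝒴 → ℝ) (t : ℝ) : ℝ :=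
  Real.log (partition (jointDist P W) (likelihoodRatio W Q) t)

/-- The mean of the information density under the tilted joint distribution. -/
def tiltedInfo (P : 𝒳 → ℝ) (W : 𝒳 → 𝒴 → ℝ) (Q : 𝒴 → ℝ) (t : ℝ) : ℝ :=
  ∑ z, tilted (jointDist P W) (likelihoodRatio W Q) t z * Real.log (likelihoodRatio W Q z)

variable {M : ℕ → ℕ} {R s t : ℝ}

theorem eventually_iidResolvability_le (hW : ∀ x, W x ∈ stdSimplex ℝ 𝒴) (hP : P ∈ inducing W Q)
    (hR : 0 < R) (hM : Tendsto (fun n : ℕ => Real.log (M n) / n) atTop (𝓝 R))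
    (hs : -1 < s) (hst : s ≤ t) (ht0 : 0 < t) (ht : t ≤ 1) {ε : ℝ} (hε : 0 < ε) :
    ∀ᶠ n : ℕ in atTop, iidResolvability s n (M n) P W Q ≤
      Real.exp (-(n * (t * R - infoCgf P W Q t - ε))) := by
  have hQ := output_mem_stdSimplex hW hP
  have hJ := jointDist_mem_stdSimplex hW hP.1
  have hℓ := likelihoodRatio_nonneg hW hQ
  set C := if 0 < s then 1 / s else 1 / t with hC
  have hC0 : 0 < C := by
    rw [hC]
    split_ifs with h <;> positivity
  filter_upwards [eventually_le_exp_mul C (half_pos hε), eventually_rate hR hM (half_pos hε)]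
    with n hCn hMn
  obtain ⟨hM0, hMlo, -⟩ := hMn
  rw [iidResolvability_eq_ratioDiv hW hP hs]
  refine (ratioDiv_codeRatio_le (iidDist_mem_stdSimplex hP.1) (iidDist_mem_stdSimplex hQ)
    (fun x y => Finset.prod_nonneg fun i _ => hℓ _)
    (sum_iidDist_mul_likelihoodRatio hP n) hM0 hs hst ht0 ht).trans ?_
  rw [sum_iidDist_prod n (likelihoodRatio W Q) (fun x => x ^ (1 + t)),
    expIid_prod_rpow hJ hℓ (jointDist_eq_prodDist_mul hW hP) ht0.le,
    pow_eq_exp_mul_log (partition_pos hJ t)]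
  have h1 : (M n : ℝ) ^ (-t) ≤ Real.exp (n * (R - ε / 2) * -t) := by
    rw [← rpow_exp_mul]
    exact Real.rpow_le_rpow_of_nonpos (Real.exp_pos _) hMlo (by linarith)
  calc C * ((M n : ℝ) ^ (-t) * Real.exp (n * infoCgf P W Q t))
      ≤ Real.exp (n * (ε / 2)) *
          (Real.exp (n * (R - ε / 2) * -t) * Real.exp (n * infoCgf P W Q t)) := by gcongr
    _ = Real.exp (-(n * (t * R - infoCgf P W Q t - (1 + t) * (ε / 2)))) := by
        rw [← Real.exp_add, ← Real.exp_add]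
        ring_nf
    _ ≤ _ := by
        gcongr
        nlinarith

/-- With truncation level `B ≈ e^{nμ}`, the condition `μ ≤ R` keeps `B / M` subexponential. On the
typical window `f ^ 2 ≈ e^{nμ(1-t)} f ^ (1 + t)`, and `hcrit` turns the resulting exponent `R - (1 -
t)μ - K(t)` into `tR - K(t)`. -/
theorem eventually_le_iidResolvability (hW : ∀ x, W x ∈ stdSimplex ℝ 𝒴) (hP : P ∈ inducing W Q)
    (hR : 0 < R) (hM : Tendsto (fun n : ℕ => Real.log (M n) / n) atTop (𝓝 R))
    (hs : -1 < s) (ht0 : 0 ≤ t) (ht : t ≤ 1) (hpos : 0 < tiltedInfo P W Q t)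
    (hle : tiltedInfo P W Q t ≤ R) (hcrit : (1 - t) * (R - tiltedInfo P W Q t) = 0)
    {ε : ℝ} (hε : 0 < ε) :
    ∀ᶠ n : ℕ in atTop, Real.exp (-(n * (t * R - infoCgf P W Q t + ε))) ≤
      iidResolvability s n (M n) P W Q := by
  have hQ := output_mem_stdSimplex hW hP
  have hJ := jointDist_mem_stdSimplex hW hP.1
  have hℓ := likelihoodRatio_nonneg hW hQ
  set μ := tiltedInfo P W Q t with hμ
  -- The losses are `δ` for the constant, `5δ` for `M (1 + B / M)²` and `(1 - t)δ` for the window.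
  -- The bound `μ / 2` keeps `μ - δ` positive, so typical ratios exceed 2.
  set δ := min (ε / 7) (μ / 2) with hδ
  have hδ0 : 0 < δ := lt_min (by linarith) (by linarith)
  have hδε : 7 * δ ≤ ε := by linarith [min_le_left (ε / 7) (μ / 2)]
  have hδμ : 0 < μ - δ := by linarith [min_le_right (ε / 7) (μ / 2)]
  obtain ⟨c, hc, hcs⟩ := le_ratioDiv_codeRatio hs
  filter_upwards [eventually_exp_neg_mul_le (show 0 < c / 8 by positivity) hδ0,
    eventually_rate hR hM hδ0, eventually_le_exp_mul 2 hδμ,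
    eventually_half_partition_le_expIid hJ hℓ (jointDist_eq_prodDist_mul hW hP) ht0 hμ.symm hδ0]
    with n hcn hMn hn2 htilt
  obtain ⟨hM0, hMlo, hMup⟩ := hMn
  have hM1 : (0 : ℝ) < M n := by positivity
  have hn0 : (0 : ℝ) ≤ n := Nat.cast_nonneg n
  set B := Real.exp (n * (μ + δ)) with hB
  have hB2 : 2 ≤ B := hn2.trans (by rw [hB]; gcongr; linarith)
  rw [iidResolvability_eq_ratioDiv hW hP hs]
  refine le_trans ?_ (hcs (iidDist_mem_stdSimplex hP.1) (iidDist_mem_stdSimplex hQ)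
    (fun x y => Finset.prod_nonneg fun i _ => hℓ _)
    (sum_iidDist_mul_likelihoodRatio hP n) hM0 B hB2)
  rw [sum_iidDist_prod n (likelihoodRatio W Q) (fun x => if 2 ≤ x ∧ x ≤ B then x ^ 2 else 0)]
  have hsq : Real.exp (n * (μ - δ) * (1 - t)) * (1 / 2 * Real.exp (n * infoCgf P W Q t)) ≤
      expIid n (prodDist P Q) (fun z =>
        if 2 ≤ ∏ i, likelihoodRatio W Q (z i) ∧ ∏ i, likelihoodRatio W Q (z i) ≤ B
        then (∏ i, likelihoodRatio W Q (z i)) ^ 2 else 0) := by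
    rw [infoCgf, ← pow_eq_exp_mul_log (partition_pos hJ t)]
    refine (mul_le_mul_of_nonneg_left htilt (Real.exp_pos _).le).trans ?_
    rw [← expIid_const_mul]
    refine expIid_mono (prodDist_mem_stdSimplex hP.1 hQ).1 fun z => ?_
    set x := ∏ i, likelihoodRatio W Q (z i) with hx
    have hx0 : 0 ≤ x := Finset.prod_nonneg fun i _ => hℓ _
    split_ifs with h1 h2 h2
    · have hx1 : 0 < x := (Real.exp_pos _).trans_le h1.1
      calc _ = Real.exp (n * (μ - δ)) ^ (1 - t) * x ^ (1 + t) := by rw [rpow_exp_mul]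
        _ ≤ x ^ (1 - t) * x ^ (1 + t) := by
          gcongr
          exact h1.1
        _ = x ^ 2 := by
          rw [← Real.rpow_add hx1, ← Real.rpow_natCast]
          norm_num
    · exact absurd ⟨hn2.trans h1.1, h1.2⟩ h2
    · rw [mul_zero]
      positivity
    · simp
  have hBM : B / M n ≤ Real.exp (n * (2 * δ)) := by
    rw [div_le_iff₀ hM1]
    calc B ≤ Real.exp (n * (2 * δ) + n * (R - δ)) := by
          rw [hB, ← mul_add]
          exact Real.exp_le_exp.2 (mul_le_mul_of_nonneg_left (by linarith) hn0)
      _ = Real.exp (n * (2 * δ)) * Real.exp (n * (R - δ)) := Real.exp_add _ _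
      _ ≤ _ := by gcongr
  have hden : (M n : ℝ) * (1 + B / M n) ^ 2 ≤ 4 * Real.exp (n * (R + 5 * δ)) := by
    have h1 : 1 ≤ Real.exp (n * (2 * δ)) := Real.one_le_exp (by positivity)
    calc _ ≤ Real.exp (n * (R + δ)) *
          (Real.exp (n * (2 * δ)) + Real.exp (n * (2 * δ))) ^ 2 := by gcongr
      _ = 4 * (Real.exp (n * (R + δ)) * Real.exp (n * (2 * δ)) * Real.exp (n * (2 * δ))) := by ring
      _ = _ := by
        rw [← Real.exp_add, ← Real.exp_add]
        ring_nf
  calc Real.exp (-(n * (t * R - infoCgf P W Q t + ε)))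
      ≤ Real.exp (-(n * δ) - n * (R + 5 * δ) + n * (μ - δ) * (1 - t) + n * infoCgf P W Q t) := by
        gcongr
        have h1 : -δ - (R + 5 * δ) + (μ - δ) * (1 - t) + infoCgf P W Q t =
          -(t * R - infoCgf P W Q t + (7 - t) * δ) := by linear_combination -hcrit
        have h2 : (7 - t) * δ ≤ ε := by nlinarith
        nlinarith [mul_le_mul_of_nonneg_left h2 hn0, congrArg (fun x => (n : ℝ) * x) h1]
    _ = Real.exp (-(n * δ)) / Real.exp (n * (R + 5 * δ)) *
          (Real.exp (n * (μ - δ) * (1 - t)) * Real.exp (n * infoCgf P W Q t)) := by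
        rw [← Real.exp_sub, ← Real.exp_add, ← Real.exp_add]
        ring_nf
    _ ≤ c / 8 / Real.exp (n * (R + 5 * δ)) *
          (Real.exp (n * (μ - δ) * (1 - t)) * Real.exp (n * infoCgf P W Q t)) := by gcongr
    _ = c / (4 * Real.exp (n * (R + 5 * δ))) *
          (Real.exp (n * (μ - δ) * (1 - t)) * (1 / 2 * Real.exp (n * infoCgf P W Q t))) := by
        field_simp
        norm_num
    _ ≤ _ := by gcongr

/-- Since the slope at `s` exceeds `R`, a ratio typical for the tilted law is larger than `2 M`, and
the single-codeword bound retains half of the `1 + s` moment. -/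
theorem eventually_le_iidResolvability_of_lt (hW : ∀ x, W x ∈ stdSimplex ℝ 𝒴)
    (hP : P ∈ inducing W Q)
    (hR : 0 < R) (hM : Tendsto (fun n : ℕ => Real.log (M n) / n) atTop (𝓝 R))
    (hs : 0 < s) (hs1 : s ≤ 1) (hcgf : infoCgf P W Q s ≤ s * R)
    (hlt : R < tiltedInfo P W Q s) {ε : ℝ} (hε : 0 < ε) :
    ∀ᶠ n : ℕ in atTop, Real.exp (-(n * (s * R - infoCgf P W Q s + ε))) ≤
      iidResolvability s n (M n) P W Q := by
  have hQ := output_mem_stdSimplex hW hP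
  have hJ := jointDist_mem_stdSimplex hW hP.1
  have hℓ := likelihoodRatio_nonneg hW hQ
  set μ := tiltedInfo P W Q s with hμ
  set k : ℝ := 1 - (2 + s) / 2 ^ (1 + s) with hk
  have hk0 : 0 < k := by
    rw [hk, sub_pos, div_lt_one (by positivity)]
    exact two_add_lt_two_rpow hs
  have hk1 : k ≤ 1 := by
    rw [hk, sub_le_self_iff]
    positivity
  set δ := min (ε / 2) ((μ - R) / 3) with hδ
  have hδ0 : 0 < δ := lt_min (by linarith) (by linarith)
  have hδε : 2 * δ ≤ ε := by linarith [min_le_left (ε / 2) ((μ - R) / 3)]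
  have hδμ : R + δ + δ ≤ μ - δ := by linarith [min_le_right (ε / 2) ((μ - R) / 3)]
  filter_upwards [eventually_exp_neg_mul_le (show 0 < 1 / s * (k / 4) by positivity) hδ0,
    eventually_rate hR hM hδ0, eventually_le_exp_mul 2 hδ0,
    eventually_half_partition_le_expIid hJ hℓ (jointDist_eq_prodDist_mul hW hP) hs.le hμ.symm hδ0]
    with n hcn hMn hn2 htilt
  obtain ⟨hM0, hMlo, hMup⟩ := hMn
  have hM1 : (0 : ℝ) < M n := by positivity
  have hn0 : (0 : ℝ) ≤ n := Nat.cast_nonneg n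
  rw [iidResolvability_eq_ratioDiv hW hP (by linarith)]
  set z := k * (Real.exp (n * (R + δ) * -s) * (1 / 2 * Real.exp (n * infoCgf P W Q s))) with hz
  have hz0 : 0 ≤ z := by positivity
  have hexp : Real.exp (n * (R + δ) * -s) * Real.exp (n * infoCgf P W Q s) =
      Real.exp (-(n * (s * R - infoCgf P W Q s + s * δ))) := by
    rw [← Real.exp_add]
    ring_nf
  -- The hypothesis `hcgf` makes the exponent nonnegative, so the logarithm may be linearized.
  have hz1 : z ≤ 1 := by
    have h1 : Real.exp (-(n * (s * R - infoCgf P W Q s + s * δ))) ≤ 1 := by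
      rw [Real.exp_le_one_iff, neg_nonpos]
      exact mul_nonneg hn0 (by nlinarith)
    have h2 : z = k * (1 / 2 * Real.exp (-(n * (s * R - infoCgf P W Q s + s * δ)))) := by
      rw [hz, ← hexp]
      ring
    rw [h2]
    exact mul_le_one₀ hk1 (by positivity) (by linarith)
  refine le_trans ?_ (le_ratioDiv_codeRatio_of_pos (iidDist_mem_stdSimplex hP.1)
    (iidDist_mem_stdSimplex hQ) (fun x y => Finset.prod_nonneg fun i _ => hℓ _)
    (sum_iidDist_mul_likelihoodRatio hP n) hM0 hs hz0 hz1 ?_)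
  · calc Real.exp (-(n * (s * R - infoCgf P W Q s + ε)))
        ≤ Real.exp (-(n * δ) + -(n * (s * R - infoCgf P W Q s + s * δ))) := by
          gcongr
          have h2 : δ + s * δ ≤ ε := by nlinarith
          nlinarith [mul_le_mul_of_nonneg_left h2 hn0]
      _ = Real.exp (-(n * δ)) * (Real.exp (n * (R + δ) * -s) * Real.exp (n * infoCgf P W Q s)) := by
          rw [Real.exp_add, hexp]
      _ ≤ 1 / s * (k / 4) *
          (Real.exp (n * (R + δ) * -s) * Real.exp (n * infoCgf P W Q s)) := by gcongr
      _ = _ := by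
          rw [hz]
          ring
  · rw [hz, sum_iidDist_prod n (likelihoodRatio W Q)
      (fun x => if 2 * (M n : ℝ) ≤ x then x ^ (1 + s) else 0)]
    refine mul_le_mul_of_nonneg_left (mul_le_mul ?_ ?_ (by positivity) (by positivity)) hk0.le
    · rw [← rpow_exp_mul]
      exact Real.rpow_le_rpow_of_nonpos hM1 hMup (by linarith)
    · rw [infoCgf, ← pow_eq_exp_mul_log (partition_pos hJ s)]
      refine htilt.trans (expIid_mono (prodDist_mem_stdSimplex hP.1 hQ).1 fun z => ?_)
      have hx0 : 0 ≤ ∏ i, likelihoodRatio W Q (z i) := Finset.prod_nonneg fun i _ => hℓ _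
      have h2M : 2 * (M n : ℝ) ≤ Real.exp (n * (μ - δ)) :=
        calc 2 * (M n : ℝ) ≤ Real.exp (n * δ) * Real.exp (n * (R + δ)) := by gcongr
          _ = Real.exp (n * (R + δ + δ)) := by
            rw [← Real.exp_add]
            ring_nf
          _ ≤ _ := by gcongr
      split_ifs with h1 h2 h2
      · rfl
      · exact absurd (h2M.trans h1.1) h2
      · positivity
      · rfl

end channel

/-! ### Convexity of the cumulant generating function and first-order conditions at the maximizer.
-/

section channel

variable {𝒳 𝒴 : Type*} [Fintype 𝒳] [Fintype 𝒴] {W : 𝒳 → 𝒴 → ℝ} {P : 𝒳 → ℝ} {Q : 𝒴 → ℝ}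

theorem partition_zero {γ : Type*} [Fintype γ] {p ℓ : γ → ℝ} (hp : p ∈ stdSimplex ℝ γ) :
    partition p ℓ 0 = 1 := by
  simp [partition, hp.2]

theorem infoCgf_zero (hW : ∀ x, W x ∈ stdSimplex ℝ 𝒴) (hP : P ∈ inducing W Q) :
    infoCgf P W Q 0 = 0 := by
  rw [infoCgf, partition_zero (jointDist_mem_stdSimplex hW hP.1), Real.log_one]

theorem continuous_partition {γ : Type*} [Fintype γ] (p ℓ : γ → ℝ) :
    Continuous (partition p ℓ) := by
  unfold partition
  fun_prop

theorem continuous_infoCgf (hW : ∀ x, W x ∈ stdSimplex ℝ 𝒴) (hP : P ∈ inducing W Q) :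
    Continuous (infoCgf P W Q) :=
  (continuous_partition _ _).log fun t =>
    (partition_pos (jointDist_mem_stdSimplex hW hP.1) t).ne'

theorem continuous_tiltedInfo (hW : ∀ x, W x ∈ stdSimplex ℝ 𝒴) (hP : P ∈ inducing W Q) :
    Continuous (tiltedInfo P W Q) := by
  unfold tiltedInfo tilted
  refine continuous_finsetSum _ fun z _ => (Continuous.div (by fun_prop)
    (continuous_partition _ _) fun t => ?_).mul continuous_const
  exact (partition_pos (jointDist_mem_stdSimplex hW hP.1) t).ne'

/-- The cumulant generating function lies above its tangents. -/
theorem infoCgf_add_le (hW : ∀ x, W x ∈ stdSimplex ℝ 𝒴) (hP : P ∈ inducing W Q) (t u : ℝ) :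
    infoCgf P W Q t + tiltedInfo P W Q t * (u - t) ≤ infoCgf P W Q u := by
  have hJ := jointDist_mem_stdSimplex hW hP.1
  have ht := partition_pos (ℓ := likelihoodRatio W Q) hJ t
  have hρ := tilted_mem_stdSimplex (ℓ := likelihoodRatio W Q) hJ t
  -- The difference of the two values is the logarithm of a tilted mean of `exp ((u - t) log ℓ)`, so
  -- Jensen replaces differentiation.
  have h := exp_sum_le_sum_exp hρ.1 hρ.2
    (fun z => (u - t) * Real.log (likelihoodRatio W Q z))
  have h1 : ∑ z, tilted (jointDist P W) (likelihoodRatio W Q) t z *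
      Real.exp ((u - t) * Real.log (likelihoodRatio W Q z)) =
        partition (jointDist P W) (likelihoodRatio W Q) u /
          partition (jointDist P W) (likelihoodRatio W Q) t := by
    simp only [tilted, partition, Finset.sum_div]
    refine Finset.sum_congr rfl fun z _ => ?_
    rw [div_mul_eq_mul_div, mul_assoc, ← Real.exp_add]
    ring_nf
  have h2 : ∑ z, tilted (jointDist P W) (likelihoodRatio W Q) t z *
      ((u - t) * Real.log (likelihoodRatio W Q z)) = tiltedInfo P W Q t * (u - t) := by
    rw [tiltedInfo, Finset.sum_mul]
    exact Finset.sum_congr rfl fun z _ => by ring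
  have hu := partition_pos (ℓ := likelihoodRatio W Q) hJ u
  rw [h1, h2, ← Real.le_log_iff_exp_le (div_pos hu ht), Real.log_div hu.ne' ht.ne'] at h
  rw [infoCgf, infoCgf]
  linarith

theorem tiltedInfo_zero (hW : ∀ x, W x ∈ stdSimplex ℝ 𝒴) (hP : P ∈ inducing W Q) :
    tiltedInfo P W Q 0 = condRelEntropy W Q P := by
  simp only [tiltedInfo, tilted, partition_zero (jointDist_mem_stdSimplex hW hP.1), zero_mul,
    Real.exp_zero, mul_one, div_one, condRelEntropy, relEntropy, jointDist, likelihoodRatio,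
    Fintype.sum_prod_type, Finset.mul_sum, mul_assoc]

theorem condRelEntropy_nonneg (hW : ∀ x, W x ∈ stdSimplex ℝ 𝒴) (hP : P ∈ inducing W Q) :
    0 ≤ condRelEntropy W Q P := by
  have hQ := output_mem_stdSimplex hW hP
  have hJ := jointDist_mem_stdSimplex hW hP.1
  have hπ := prodDist_mem_stdSimplex hP.1 hQ
  have h : ∑ z, (jointDist P W z - prodDist P Q z) ≤
      ∑ z, jointDist P W z * Real.log (likelihoodRatio W Q z) := by
    refine Finset.sum_le_sum fun z _ => ?_
    have e := jointDist_eq_prodDist_mul hW hP z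
    rcases (likelihoodRatio_nonneg hW hQ z).eq_or_lt with h0 | h0
    · rw [e, ← h0]
      simpa using hπ.1 z
    · have := mul_le_mul_of_nonneg_left (Real.one_sub_inv_le_log_of_pos h0) (hJ.1 z)
      refine le_trans (le_of_eq ?_) this
      rw [e]
      field_simp
  rw [Finset.sum_sub_distrib, hJ.2, hπ.2, sub_self] at h
  rw [← tiltedInfo_zero hW hP]
  simpa [tiltedInfo, tilted, partition_zero hJ] using h

theorem infoCgf_nonneg (hW : ∀ x, W x ∈ stdSimplex ℝ 𝒴) (hP : P ∈ inducing W Q) {t : ℝ}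
    (ht : 0 ≤ t) : 0 ≤ infoCgf P W Q t := by
  have h := infoCgf_add_le hW hP 0 t
  rw [infoCgf_zero hW hP, tiltedInfo_zero hW hP] at h
  have := mul_nonneg (condRelEntropy_nonneg hW hP) ht
  linarith

/-- The partition function at 1 exceeds 1 by the chi-squared divergence, which is zero only if the
joint law is the product. -/
theorem infoCgf_one_pos (hW : ∀ x, W x ∈ stdSimplex ℝ 𝒴) (hP : P ∈ inducing W Q)
    (hdep : jointDist P W ≠ prodDist P Q) : 0 < infoCgf P W Q 1 := by
  have hQ := output_mem_stdSimplex hW hP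
  have hJ := jointDist_mem_stdSimplex hW hP.1
  have hπ := prodDist_mem_stdSimplex hP.1 hQ
  have e := jointDist_eq_prodDist_mul hW hP
  obtain ⟨z, hz⟩ := Function.ne_iff.1 hdep
  have hnn (z : 𝒳 × 𝒴) : 0 ≤ prodDist P Q z * (likelihoodRatio W Q z - 1) ^ 2 :=
    mul_nonneg (hπ.1 z) (sq_nonneg _)
  have hpos : 0 < ∑ z, prodDist P Q z * (likelihoodRatio W Q z - 1) ^ 2 := by
    refine Finset.sum_pos' (fun z _ => hnn z) ⟨z, Finset.mem_univ z, lt_of_le_of_ne (hnn z) ?_⟩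
    intro h
    apply hz
    rcases mul_eq_zero.1 h.symm with h | h
    · rw [e, h, zero_mul]
    · rw [e, sub_eq_zero.1 (pow_eq_zero_iff two_ne_zero |>.1 h), mul_one]
  have hZ : partition (jointDist P W) (likelihoodRatio W Q) 1 =
      ∑ z, prodDist P Q z * (likelihoodRatio W Q z - 1) ^ 2 + 1 := by
    rw [← sum_mul_rpow_eq_partition (likelihoodRatio_nonneg hW hQ) e zero_le_one]
    have e2 (z : 𝒳 × 𝒴) : prodDist P Q z * likelihoodRatio W Q z ^ (1 + 1 : ℝ) =
        prodDist P Q z * (likelihoodRatio W Q z - 1) ^ 2 + 2 * jointDist P W z -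
          prodDist P Q z := by
      rw [e, one_add_one_eq_two, Real.rpow_two]
      ring
    simp only [e2, Finset.sum_sub_distrib, Finset.sum_add_distrib, ← Finset.mul_sum, hJ.2, hπ.2]
    ring
  rw [infoCgf, hZ]
  exact Real.log_pos (by linarith)

theorem mul_renyiDiv_eq_infoCgf (hW : ∀ x, W x ∈ stdSimplex ℝ 𝒴) (hP : P ∈ inducing W Q) {t : ℝ}
    (ht : 0 ≤ t) : t * renyiDiv t (jointDist P W) (prodDist P Q) = infoCgf P W Q t := by
  have hQ := output_mem_stdSimplex hW hP
  rcases ht.eq_or_lt with rfl | h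
  · rw [zero_mul, infoCgf_zero hW hP]
  · rw [renyiDiv_eq_ratioDiv (prodDist_mem_stdSimplex hP.1 hQ).1 (likelihoodRatio_nonneg hW hQ)
      (jointDist_eq_prodDist_mul hW hP) (by linarith), ratioDiv, if_neg h.ne',
      sum_mul_rpow_eq_partition (likelihoodRatio_nonneg hW hQ) (jointDist_eq_prodDist_mul hW hP) ht,
      infoCgf]
    field_simp

/-- The function that the exponent maximizes. -/
def exponentFun (R : ℝ) (P : 𝒳 → ℝ) (W : 𝒳 → 𝒴 → ℝ) (Q : 𝒴 → ℝ) (t : ℝ) : ℝ :=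
  t * R - infoCgf P W Q t

variable {M : ℕ → ℕ} {R s t : ℝ}

theorem exponentFun_le (hW : ∀ x, W x ∈ stdSimplex ℝ 𝒴) (hP : P ∈ inducing W Q) (t u : ℝ) :
    exponentFun R P W Q u ≤ exponentFun R P W Q t + (R - tiltedInfo P W Q t) * (u - t) := by
  have := infoCgf_add_le hW hP t u
  simp only [exponentFun]
  linarith

/-- First-order condition without derivatives: the tangent at `u < t` and maximality at `t` give
`tiltedInfo P W Q u ≤ R`, and continuity lets `u` tend to `t`. -/
theorem tiltedInfo_le_of_isMaxOn (hW : ∀ x, W x ∈ stdSimplex ℝ 𝒴) (hP : P ∈ inducing W Q)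
    (hmax : IsMaxOn (exponentFun R P W Q) (Set.Icc 0 1) t) (ht0 : 0 < t) (ht : t ≤ 1) :
    tiltedInfo P W Q t ≤ R := by
  refine le_of_tendsto ((continuous_tiltedInfo hW hP).continuousWithinAt (s := Set.Iio t)) ?_
  filter_upwards [Ioo_mem_nhdsLT ht0] with u hu
  have h1 := hmax (⟨hu.1.le, hu.2.le.trans ht⟩ : u ∈ Set.Icc 0 1)
  have h2 := exponentFun_le (R := R) hW hP u t
  have h3 : 0 ≤ (R - tiltedInfo P W Q u) * (t - u) := by
    have : exponentFun R P W Q u ≤ exponentFun R P W Q t := h1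
    linarith
  linarith [nonneg_of_mul_nonneg_left h3 (sub_pos.2 hu.2)]

theorem le_tiltedInfo_of_isMaxOn (hW : ∀ x, W x ∈ stdSimplex ℝ 𝒴) (hP : P ∈ inducing W Q)
    (hmax : IsMaxOn (exponentFun R P W Q) (Set.Icc 0 1) t) (ht0 : 0 ≤ t) (ht : t < 1) :
    R ≤ tiltedInfo P W Q t := by
  refine ge_of_tendsto ((continuous_tiltedInfo hW hP).continuousWithinAt (s := Set.Ioi t)) ?_
  filter_upwards [Ioo_mem_nhdsGT ht] with u hu
  have h1 : exponentFun R P W Q u ≤ exponentFun R P W Q t :=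
    hmax (⟨ht0.trans hu.1.le, hu.2.le⟩ : u ∈ Set.Icc 0 1)
  have h2 := exponentFun_le (R := R) hW hP u t
  nlinarith [hu.1]

/-- The exponent if it is attained at a maximizer over the whole interval `[0, 1]`. -/
theorem tendsto_iidResolvability_of_isMaxOn (hW : ∀ x, W x ∈ stdSimplex ℝ 𝒴)
    (hP : P ∈ inducing W Q) (hdep : jointDist P W ≠ prodDist P Q) (hR : 0 < R)
    (hM : Tendsto (fun n : ℕ => Real.log (M n) / n) atTop (𝓝 R)) (hs : -1 < s) (hst : s ≤ t)
    (ht0 : 0 < t) (ht : t ≤ 1) (hmax : IsMaxOn (exponentFun R P W Q) (Set.Icc 0 1) t) :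
    (∀ᶠ n : ℕ in atTop, 0 < iidResolvability s n (M n) P W Q) ∧
    Tendsto (fun n : ℕ => -(1 / (n : ℝ)) * Real.log (iidResolvability s n (M n) P W Q))
      atTop (𝓝 (exponentFun R P W Q t)) := by
  have hle := tiltedInfo_le_of_isMaxOn hW hP hmax ht0 ht
  -- An interior maximizer has slope exactly `R > 0`. At `t = 1` the tangent evaluated at 0 gives
  -- slope at least `infoCgf P W Q 1 > 0`.
  have hcrit : (1 - t) * (R - tiltedInfo P W Q t) = 0 ∧ 0 < tiltedInfo P W Q t := by
    rcases ht.eq_or_lt with rfl | h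
    · refine ⟨by ring, (infoCgf_one_pos hW hP hdep).trans_le ?_⟩
      have := infoCgf_add_le hW hP 1 0
      rw [infoCgf_zero hW hP] at this
      linarith
    · have h1 := hle.antisymm (le_tiltedInfo_of_isMaxOn hW hP hmax ht0.le h)
      rw [h1]
      exact ⟨by ring, hR⟩
  exact tendsto_exponent
    (fun ε hε => eventually_le_iidResolvability hW hP hR hM hs ht0.le ht hcrit.2 hle hcrit.1 hε)
    (fun ε hε => eventually_iidResolvability_le hW hP hR hM hs hst ht0 ht hε)

/-- The exponent if it is attained at the left end of the interval `[s, 1]`. -/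
theorem tendsto_iidResolvability_of_lt_tiltedInfo (hW : ∀ x, W x ∈ stdSimplex ℝ 𝒴)
    (hP : P ∈ inducing W Q) (hR : 0 < R)
    (hM : Tendsto (fun n : ℕ => Real.log (M n) / n) atTop (𝓝 R)) (hs : 0 < s) (hs1 : s ≤ 1)
    (hpos : 0 ≤ exponentFun R P W Q s) (hlt : R < tiltedInfo P W Q s) :
    (∀ᶠ n : ℕ in atTop, 0 < iidResolvability s n (M n) P W Q) ∧
    Tendsto (fun n : ℕ => -(1 / (n : ℝ)) * Real.log (iidResolvability s n (M n) P W Q))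
      atTop (𝓝 (exponentFun R P W Q s)) :=
  tendsto_exponent
    (fun ε hε => eventually_le_iidResolvability_of_lt hW hP hR hM hs hs1
      (sub_nonneg.1 hpos) hlt hε)
    (fun ε hε => eventually_iidResolvability_le hW hP hR hM (by linarith) le_rfl hs hs1 hε)

theorem exponentValues_eq (hW : ∀ x, W x ∈ stdSimplex ℝ 𝒴) (hP : P ∈ inducing W Q) :
    exponentValues s R P W Q =
      exponentFun R P W Q '' (if 0 < s then Set.Icc s 1 else Set.Icc 0 1) := by
  refine Set.image_congr fun t ht => ?_
  have ht0 : 0 ≤ t := by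
    split_ifs at ht with h
    exacts [h.le.trans ht.1, ht.1]
  rw [mul_sub, mul_renyiDiv_eq_infoCgf hW hP ht0, exponentFun]

theorem isGreatest_exponentValues (hW : ∀ x, W x ∈ stdSimplex ℝ 𝒴) (hP : P ∈ inducing W Q)
    (ht : t ∈ if 0 < s then Set.Icc s 1 else Set.Icc 0 1)
    (hmax : IsMaxOn (exponentFun R P W Q) (if 0 < s then Set.Icc s 1 else Set.Icc 0 1) t) :
    IsGreatest (exponentValues s R P W Q) (exponentFun R P W Q t) := by
  rw [exponentValues_eq hW hP]
  refine ⟨Set.mem_image_of_mem _ ht, ?_⟩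
  rintro _ ⟨u, hu, rfl⟩
  exact hmax hu

end channel

end Resolvability

end

theorem theorem5 {𝒳 𝒴 : Type*} [Fintype 𝒳] [Fintype 𝒴]
    (W : 𝒳 → 𝒴 → ℝ) (hW : ∀ x, W x ∈ stdSimplex ℝ 𝒴)
    (Q : 𝒴 → ℝ) (P : 𝒳 → ℝ) (hP : P ∈ Resolvability.inducing W Q)
    -- `X` and `Y` are not independent
    (hdep : Resolvability.jointDist P W ≠ Resolvability.prodDist P Q)
    (s : ℝ) (hs : s ∈ Set.Ioc (-1 : ℝ) 1) (R : ℝ)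
    (hRpos : 0 < s → Resolvability.renyiDiv s (Resolvability.jointDist P W)
      (Resolvability.prodDist P Q) < R)
    (hRneg : s ≤ 0 → Resolvability.condRelEntropy W Q P < R)
    -- `M n` is the number of messages at blocklength `n`; the code has rate `R`
    (M : ℕ → ℕ) (hM : Tendsto (fun n : ℕ => Real.log (M n) / n) atTop (𝓝 R)) :
    IsGreatest (Resolvability.exponentValues s R P W Q) (Resolvability.Eiid s R P W Q) ∧
    (∀ᶠ n : ℕ in atTop, 0 < Resolvability.iidResolvability s n (M n) P W Q) ∧
    Tendsto (fun n : ℕ => -(1 / (n : ℝ)) *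
        Real.log (Resolvability.iidResolvability s n (M n) P W Q))
      atTop (𝓝 (Resolvability.Eiid s R P W Q)) := by
  open Resolvability in
  have hcont : Continuous (exponentFun R P W Q) :=
    (continuous_id.mul continuous_const).sub (continuous_infoCgf hW hP)
  have hzero : exponentFun R P W Q 0 = 0 := by simp [exponentFun, infoCgf_zero hW hP]
  suffices h : ∃ t ∈ (if 0 < s then Set.Icc s 1 else Set.Icc 0 1),
      IsMaxOn (exponentFun R P W Q) (if 0 < s then Set.Icc s 1 else Set.Icc 0 1) t ∧
      (∀ᶠ n : ℕ in atTop, 0 < iidResolvability s n (M n) P W Q) ∧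
      Tendsto (fun n : ℕ => -(1 / (n : ℝ)) * Real.log (iidResolvability s n (M n) P W Q))
        atTop (𝓝 (exponentFun R P W Q t)) by
    obtain ⟨t, ht, hmax, h⟩ := h
    have hg := isGreatest_exponentValues hW hP ht hmax
    have hE : Eiid s R P W Q = exponentFun R P W Q t := hg.csSup_eq
    rw [hE]
    exact ⟨hg, h⟩
  -- The maximizer over all of `[0, 1]`, whatever `s` is; it decides which lower bound applies.
  obtain ⟨t₀, ht₀, hmax₀⟩ := isCompact_Icc.exists_isMaxOn (Set.nonempty_Icc.2 zero_le_one)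
    (hcont.continuousOn (s := Set.Icc 0 1))
  rcases le_or_gt s 0 with hs0 | hs0
  · have hR := hRneg hs0
    -- A maximizer at 0 would force the slope there, `condRelEntropy W Q P`, to be at least `R`.
    have ht₀0 : 0 < t₀ := by
      refine lt_of_le_of_ne ht₀.1 ?_
      rintro rfl
      have := le_tiltedInfo_of_isMaxOn hW hP hmax₀ le_rfl zero_lt_one
      rw [tiltedInfo_zero hW hP] at this
      linarith
    simp only [if_neg hs0.not_gt]
    exact ⟨t₀, ht₀, hmax₀, tendsto_iidResolvability_of_isMaxOn hW hP hdep
      ((condRelEntropy_nonneg hW hP).trans_lt hR) hM hs.1 (hs0.trans ht₀0.le) ht₀0 ht₀.2 hmax₀⟩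
  · have hgs : 0 < exponentFun R P W Q s := by
      have := mul_lt_mul_of_pos_left (hRpos hs0) hs0
      rw [mul_renyiDiv_eq_infoCgf hW hP hs0.le] at this
      exact sub_pos.2 this
    have hR : 0 < R := by
      have h1 := infoCgf_nonneg hW hP hs0.le
      have h2 : 0 < s * R := by
        rw [exponentFun] at hgs
        linarith
      exact pos_of_mul_pos_right h2 hs0.le
    obtain ⟨t₁, ht₁, hmax₁⟩ := isCompact_Icc.exists_isMaxOn (Set.nonempty_Icc.2 hs.2)
      (hcont.continuousOn (s := Set.Icc s 1))
    have hs1 : exponentFun R P W Q s ≤ exponentFun R P W Q t₁ := hmax₁ ⟨le_rfl, hs.2⟩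
    simp only [if_pos hs0]
    -- Either the maximum over `[s, 1]` is already the one over `[0, 1]`, or the latter is attained
    -- only below `s`. In the second case the tangent at `s`, evaluated at `t₀`, gives slope greater
    -- than `R`, and the same tangent makes `s` the maximizer over `[s, 1]`.
    rcases le_or_gt (exponentFun R P W Q t₀) (exponentFun R P W Q t₁) with h | h
    · exact ⟨t₁, ht₁, hmax₁, tendsto_iidResolvability_of_isMaxOn hW hP hdep hR hM hs.1 ht₁.1
        (hs0.trans_le ht₁.1) ht₁.2 fun u hu => (hmax₀ hu).trans h⟩
    · have hts : t₀ < s := by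
        by_contra hge
        exact h.not_ge (hmax₁ ⟨not_lt.1 hge, ht₀.2⟩)
      have hlt : R < tiltedInfo P W Q s := by
        have := exponentFun_le (R := R) hW hP s t₀
        nlinarith
      refine ⟨s, ⟨le_rfl, hs.2⟩, fun u hu => ?_,
        tendsto_iidResolvability_of_lt_tiltedInfo hW hP hR hM hs0 hs.2 hgs.le hlt⟩
      have := exponentFun_le (R := R) hW hP s u
      have := mul_nonneg (sub_pos.2 hlt).le (sub_nonneg.2 hu.1)
      show exponentFun R P W Q u ≤ exponentFun R P W Q s
      linarith
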